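/- **Conventions.** $\{0,1\}^m$ is the set of bit strings of length $m$, and a string $x$ is identified with the density operator $|x\rangle\langle x|$; $\varepsilon$ is the empty string. A *gate set* $\mathcal G$ is a finite set of channels, each of which is a conjugation $L\mapsto ULU^\dagger$ by a unitary $U$ on finitely many qubits with algebraic entries in the computational basis, the preparation $c\mapsto c\,|0\rangle\langle 0|$ of one qubit, or the trace of one qubit. A *circuit* built from $\mathcal G$ is a finite composition of layers, each layer being a finite tensor product of elements of $\mathcal G$; it is an $(a,b)$-circuit if it implements a channel from $a$ qubits to $b$ qubits. For $a,b:\mathbb N\to\mathbb N$, an $(a,b)$-circuit family is a sequence $(C_n)_{n\in\mathbb N}$ of $(a(n),b(n))$-circuits $C_n$ built from one gate set. It is *uniform* if some deterministic Turing machine, on input $1^n$, outputs a description of $C_n$ (the list of the layers of $C_n$ and of the gates in each layer, in a fixed encoding by bit strings), and *exponential-time* if this machine halts within $2^{r(n)}$ steps for some polynomial $r$. Let $\ell:\mathbb N\to\mathbb N$. An *$\ell$-sequence* is a sequence $(s_n)_{n\in\mathbb N}$ with $s_n\in\{0,1\}^{\ell(n)}$ for all $n$. It is *computably* (respectively, *exponential-time*)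 *ingenerable* if for every gate set $\mathcal G$ there is a polynomial $p_{\mathcal G}:\mathbb N\to\mathbb R$ such that for every uniform (respectively, exponential-time) $(0,\ell)$-circuit family $(D_n)_{n\in\mathbb N}$ built from $\mathcal G$ one has $\langle s_n|D_n(\varepsilon)|s_n\rangle<p_{\mathcal G}(n)\,2^{-\ell(n)}$ for all but finitely many $n$. A function $f:\mathbb N\to\mathbb R$ is *negligible* if for every $c\in\mathbb N$ one has $f(n)\le n^{-c}$ for all sufficiently large $n$. **Theorem.** Let $(s_n)_{n\in\mathbb N}$ be a computably (respectively, exponential-time) ingenerable $\ell$-sequence, where $\ell:\mathbb N\to\mathbb N$ is arbitrary (respectively, $\ell\in\mathcal O(n^k)$ for some $k\in\mathbb N$). Then for every uniform (respectively, exponential-time) $(\ell,1)$-circuit family $(C_n)_{n\in\mathbb N}$, built from any gate set, there exists a polynomial $p$ such that for all sufficiently large $n$ (depending on the family) $$\langle 1|C_n(s_n)|1\rangle\;\le\;p(n)\cdot\Bigl(2^{-\ell(n)}+\mathop{\mathbb E}_{x\leftarrow\{0,1\}^{\ell(n)}}\langle 1|C_n(x)|1\rangle\Bigr),$$ where $x$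 is uniformly random. In particular, if $\ell\in\omega(\log)$ and $n\mapsto\mathbb E_{x\leftarrow\{0,1\}^{\ell(n)}}\langle 1|C_n(x)|1\rangle$ is negligible, then so is $n\mapsto\langle 1|C_n(s_n)|1\rangle$. -/

import Mathlib

open scoped Filter Asymptotics
open scoped BigOperators

noncomputable section

namespace QCirc

/-- Bit strings of length `n`; `false` is the bit `0` and `true` is the bit `1`. -/
abbrev Bits (n : ℕ) : Type := Fin n → Bool

/-- Linear operators on `n` qubits, as matrices in the computational basis. -/
abbrev Operator (n : ℕ) : Type := Matrix (Bits n) (Bits n) ℂ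

/-- Linear maps from operators on `a` qubits to operators on `b` qubits. -/
abbrev SuperOp (a b : ℕ) : Type := Operator a →ₗ[ℂ] Operator b

/-- The density operator `|x⟩⟨x|`. -/
def ketbra {n : ℕ} (x : Bits n) : Operator n := Matrix.single x x 1

/-- The first `a` qubits and the last `c` qubits of `a + c` qubits. -/
def splitBits (a c : ℕ) : Bits (a + c) ≃ Bits a × Bits c :=
  (Equiv.arrowCongr finSumFinEquiv.symm (Equiv.refl Bool)).trans
    (Equiv.sumArrowEquivProdArrow (Fin a) (Fin c) Bool)

/-- The identification of `L(H) ⊗ L(H')` with `L(H ⊗ H')` (Kronecker product). -/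
def operatorTensor (a c : ℕ) : TensorProduct ℂ (Operator a) (Operator c) ≃ₗ[ℂ] Operator (a + c) :=
  (kroneckerLinearEquiv (Bits a) (Bits a) (Bits c) (Bits c) ℂ).trans
    (Matrix.reindexLinearEquiv ℂ ℂ (splitBits a c).symm (splitBits a c).symm)

/-- The tensor product of two maps on operators. -/
def SuperOp.tensor {a b c d : ℕ} (Φ : SuperOp a b) (Ψ : SuperOp c d) : SuperOp (a + c) (b + d) :=
  (operatorTensor b d).toLinearMap ∘ₗ TensorProduct.map Φ Ψ ∘ₗ (operatorTensor a c).symm.toLinearMap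

/-- An elementary gate: a unitary with algebraic entries, the preparation of a qubit in the state
`|0⟩`, or the trace of a single qubit. -/
inductive Gate : Type
  | unitary (k : ℕ) (U : Operator k) (hU : U ∈ Matrix.unitaryGroup (Bits k) ℂ)
      (halg : ∀ x y, IsAlgebraic ℚ (U x y)) : Gate
  | prep : Gate
  | trace : Gate

/-- Number of input qubits of a gate. -/
@[reducible] def Gate.inputs : Gate → ℕ
  | .unitary k _ _ _ => k
  | .prep => 0
  | .trace => 1

/-- Number of output qubits of a gate. -/
@[reducible] def Gate.outputs : Gate → ℕ
  | .unitary k _ _ _ => k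
  | .prep => 1
  | .trace => 0

/-- The channel of a gate: `L ↦ U L U†`, `c ↦ c |0⟩⟨0|`, or `L ↦ Tr L`. The scalars are the
operators on zero qubits. -/
def Gate.channel : (g : Gate) → SuperOp g.inputs g.outputs
  | .unitary _ U _ _ => LinearMap.mulLeft ℂ U ∘ₗ LinearMap.mulRight ℂ U.conjTranspose
  | .prep => (Matrix.traceLinearMap (Bits 0) ℂ ℂ).smulRight (ketbra (n := 1) fun _ => false)
  | .trace => (Matrix.traceLinearMap (Bits 1) ℂ ℂ).smulRight (1 : Operator 0)

/-- A gate set: finitely many gates, listed so that each has a number. -/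
abbrev GateSet : Type := List Gate

/-- A layer of a circuit: gates of `G`, given by their numbers, applied in parallel to consecutive
blocks of qubits. -/
abbrev Layer (G : GateSet) : Type := List (Fin G.length)

/-- Number of input qubits of a layer. -/
@[reducible] def Layer.inputs {G : GateSet} : Layer G → ℕ
  | [] => 0
  | i :: L => (G.get i).inputs + Layer.inputs L

/-- Number of output qubits of a layer. -/
@[reducible] def Layer.outputs {G : GateSet} : Layer G → ℕ
  | [] => 0
  | i :: L => (G.get i).outputs + Layer.outputs L

/-- The tensor product of the channels of the gates in a layer. -/
def Layer.channel {G : GateSet} : (L : Layer G) → SuperOp (Layer.inputs L) (Layer.outputs L)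
  | [] => LinearMap.id
  | i :: L => SuperOp.tensor (G.get i).channel (Layer.channel L)

/-- `(a, b)`-circuits built from `G`: finite sequences of composable layers, the first layer being
applied first. The empty sequence is the identity on `a` qubits. -/
inductive Circuit (G : GateSet) : ℕ → ℕ → Type
  | nil (a : ℕ) : Circuit G a a
  | cons {b : ℕ} (L : Layer G) (C : Circuit G (Layer.outputs L) b) : Circuit G (Layer.inputs L) b

namespace Circuit

/-- The channel that a circuit implements. -/
def channel {G : GateSet} {a b : ℕ} : Circuit G a b → SuperOp a b
  | nil _ => LinearMap.id
  | cons L C => C.channel ∘ₗ Layer.channel L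

/-- `⟨y| C(x) |y⟩`: the probability that the circuit `C`, run on the string `x` and measured in the
computational basis, outputs `y`. -/
def prob {G : GateSet} {a b : ℕ} (C : Circuit G a b) (x : Bits a) (y : Bits b) : ℝ :=
  (C.channel (ketbra x) y y).re

/-- The layers of a circuit, in order. -/
def layers {G : GateSet} {a b : ℕ} : Circuit G a b → List (Layer G)
  | nil _ => []
  | cons L C => L :: C.layers

/-- The description of a layer: the gate of number `i` is written `1^(i+1) 0`, and `0` ends the
layer. -/
def layerCode {G : GateSet} (L : Layer G) : List Bool :=
  L.flatMap (fun i => List.replicate (i.val + 1) true ++ [false]) ++ [false]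

/-- The description of an `(a, b)`-circuit: `1^a 0` followed by the descriptions of its layers. -/
def code {G : GateSet} {a b : ℕ} (C : Circuit G a b) : List Bool :=
  List.replicate a true ++ [false] ++ C.layers.flatMap layerCode

end Circuit

/-- A family of circuits is uniform if some Turing machine, on input `1^n`, halts and outputs the
description of the `n`-th circuit. -/
def IsUniform {G : GateSet} {a b : ℕ → ℕ} (C : ∀ n, Circuit G (a n) (b n)) : Prop :=
  Nonempty (Turing.TM2Computable Computability.unaryEncodeNat id fun n => (C n).code)

/-- A family of circuits is exponential-time if some Turing machine does this within `2^(p(n))`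
steps, for a polynomial `p`. -/
def IsExpTime {G : GateSet} {a b : ℕ → ℕ} (C : ∀ n, Circuit G (a n) (b n)) : Prop :=
  ∃ M : Turing.TM2ComputableInTime Computability.unaryEncodeNat id fun n => (C n).code,
    ∃ p : Polynomial ℕ, ∀ n, M.time n ≤ 2 ^ p.eval n

/-- Computable `q`-ingenerability with respect to a gate set. The only string of length zero is
the input of a `(0, ℓ)`-circuit. -/
def ComputablyIngenerableWrt (G : GateSet) (q : ℕ → ℝ) {ℓ : ℕ → ℕ} (s : ∀ n, Bits (ℓ n)) : Prop :=
  ∀ C : ∀ n, Circuit G 0 (ℓ n), IsUniform C →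
    ∀ᶠ n in Filter.atTop, (C n).prob Fin.elim0 (s n) < q n

/-- Exponential-time `q`-ingenerability with respect to a gate set. -/
def ExpTimeIngenerableWrt (G : GateSet) (q : ℕ → ℝ) {ℓ : ℕ → ℕ} (s : ∀ n, Bits (ℓ n)) : Prop :=
  ∀ C : ∀ n, Circuit G 0 (ℓ n), IsExpTime C →
    ∀ᶠ n in Filter.atTop, (C n).prob Fin.elim0 (s n) < q n

/-- Computably ingenerable `ℓ`-sequences. -/
def ComputablyIngenerable {ℓ : ℕ → ℕ} (s : ∀ n, Bits (ℓ n)) : Prop :=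
  ∀ G : GateSet, ∃ p : Polynomial ℝ,
    ComputablyIngenerableWrt G (fun n => p.eval (n : ℝ) * ((2 : ℝ) ^ ℓ n)⁻¹) s

/-- Exponential-time ingenerable `ℓ`-sequences. -/
def ExpTimeIngenerable {ℓ : ℕ → ℕ} (s : ∀ n, Bits (ℓ n)) : Prop :=
  ∀ G : GateSet, ∃ p : Polynomial ℝ,
    ExpTimeIngenerableWrt G (fun n => p.eval (n : ℝ) * ((2 : ℝ) ^ ℓ n)⁻¹) s

/-- Negligible functions. -/
def Negligible (f : ℕ → ℝ) : Prop :=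
  ∀ c : ℕ, ∀ᶠ n : ℕ in Filter.atTop, f n ≤ ((n : ℝ) ^ c)⁻¹

/-- `⟨1| C(x) |1⟩` for an `(m, 1)`-circuit `C`. -/
def acceptProb {G : GateSet} {m : ℕ} (C : Circuit G m 1) (x : Bits m) : ℝ :=
  C.prob x fun _ => true

/-- The expectation of `⟨1| C(x) |1⟩` over a uniformly random string `x` of length `m`. -/
def avgAcceptProb {G : GateSet} {m : ℕ} (C : Circuit G m 1) : ℝ :=
  𝔼 x : Bits m, acceptProb C x

end QCirc

end

/-!
Rejection sampling. Let `N = 2 ^ ℓ n`, `a = acceptProb (C n) (s n)` and `e = avgAcceptProb (C n)`.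
A circuit keeps a string, initially `0…0`, and performs `N` rounds: it draws a uniformly random
string `x`, runs `C n` on it, and replaces the string kept by `x` if `C n` accepts. A round fails
with probability `1 - e` and replaces the string by `s n` with probability `a / N`, so the final
string is `s n` with probability at least `a / N * ∑ j < N, (1 - e) ^ j`, where the geometric sum is
at least `1 / (1 / N + e)`. By ingenerability this probability is less than `p n / N`, so that
`a ≤ p n * (1 / N + e)`.

The random strings come from Bell pairs, one half of which is discarded at the end of the round.
The description of the sampling circuit is written, from that of `C n`, by a program with loops over
stacks; such programs can be compiled and appended to a Turing machine.
-/

noncomputable section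

namespace QCirc

open Function StateTransition Turing

/-! ### Stack programs and Turing machines -/

section ReachesWithin

/-- `ReachesWithin f t a b`: iterating the partial step function `f` leads from `a` to `b` in at
most `t` steps. This is the propositional form of `StateTransition.EvalsToInTime`. -/
inductive ReachesWithin {σ : Type*} (f : σ → Option σ) : ℕ → σ → σ → Prop
  | refl (t : ℕ) (a : σ) : ReachesWithin f t a a
  | head {t : ℕ} {a b c : σ} (hab : f a = some b) (hbc : ReachesWithin f t b c) :
      ReachesWithin f (t + 1) a c

variable {σ : Type*} {f : σ → Option σ} {s t : ℕ} {a b c : σ}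

theorem ReachesWithin.single (h : f a = some b) : ReachesWithin f 1 a b := .head h (.refl 0 b)

theorem ReachesWithin.mono (h : ReachesWithin f s a b) (hst : s ≤ t) : ReachesWithin f t a b := by
  induction h generalizing t with
  | refl s a => exact .refl t a
  | @head s a b c hab _ ih =>
    obtain ⟨t, rfl⟩ := Nat.exists_eq_add_of_le' (Nat.le_of_add_left_le hst)
    exact .head hab (ih (by omega))

theorem ReachesWithin.trans (h : ReachesWithin f s a b) (h' : ReachesWithin f t b c) :
    ReachesWithin f (s + t) a c := by
  induction h with
  | refl s a => exact h'.mono (by omega)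
  | @head s a b c hab _ ih => exact add_right_comm s 1 t ▸ .head hab (ih h')

theorem iterate_flip_bind_none (f : σ → Option σ) (t : ℕ) : (flip bind f)^[t] none = none :=
  iterate_fixed rfl t

theorem ReachesWithin.of_iterate_eq_some (h : (flip bind f)^[t] (some a) = some b) :
    ReachesWithin f t a b := by
  induction t generalizing a with
  | zero => exact Option.some.inj h ▸ .refl 0 a
  | succ t ih =>
    rw [iterate_succ_apply, show flip bind f (some a) = f a from rfl] at h
    cases hfa : f a with
    | none => rw [hfa, iterate_flip_bind_none] at h; cases h
    | some c => exact .head hfa (ih (hfa ▸ h))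

theorem ReachesWithin.of_evalsToInTime (h : EvalsToInTime f a (some b) t) :
    ReachesWithin f t a b :=
  (of_iterate_eq_some h.evals_in_steps).mono h.steps_le_m

theorem ReachesWithin.nonempty_evalsToInTime (h : ReachesWithin f t a b) :
    Nonempty (EvalsToInTime f a (some b) t) := by
  induction h with
  | refl t a => exact ⟨⟨EvalsTo.refl f a, zero_le⟩⟩
  | @head t a b c hab _ ih =>
    obtain ⟨h⟩ := ih
    exact ⟨.trans f 1 t a b _ ⟨⟨1, hab⟩, le_rfl⟩ h⟩

end ReachesWithin

/-- Programs on stacks of bits, indexed by `K`. The program `emit k w` pushes the letters of `w` on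
the stack `k` in order, so that `w` appears reversed on top; `loop k p` pops `k` until it is empty
and runs `p b` after popping `b`; `whileTrue k p` pops `k` and runs `p` as long as the popped bit is
`true`. -/
inductive Prog (K : Type) : Type
  | emit (k : K) (w : List Bool) : Prog K
  | seq (p q : Prog K) : Prog K
  | loop (k : K) (p : Bool → Prog K) : Prog K
  | whileTrue (k : K) (p : Prog K) : Prog K

namespace Prog

variable {K : Type}

/-- The largest number of letters that a program pushes in one step. -/
def width : Prog K → ℕ
  | emit _ w => w.length
  | seq p q => max p.width q.width
  | loop _ p => max (p false).width (p true).width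
  | whileTrue _ p => p.width

/-- The labels of the compiled program. -/
@[reducible] def Label : Prog K → Type
  | emit _ _ => Unit
  | seq p q => p.Label ⊕ q.Label
  | loop _ p => Option (Σ b, (p b).Label)
  | whileTrue _ p => Option p.Label

instance fintypeLabel : (p : Prog K) → Fintype p.Label
  | emit _ _ => inferInstanceAs (Fintype Unit)
  | seq p q => @instFintypeSum _ _ p.fintypeLabel q.fintypeLabel
  | loop _ p => @instFintypeOption _ (@Sigma.instFintype _ _ (fun b => (p b).fintypeLabel) _)
  | whileTrue _ p => @instFintypeOption _ p.fintypeLabel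

/-- The label at which the compiled program starts. -/
def entry : (p : Prog K) → p.Label
  | emit _ _ => ()
  | seq p _ => .inl p.entry
  | loop _ _ => none
  | whileTrue _ _ => none

variable [DecidableEq K]

/-- `Exec p T T' t`: the program `p` turns the stacks `T` into `T'` within `t` steps. -/
inductive Exec : Prog K → (K → List Bool) → (K → List Bool) → ℕ → Prop
  | emit {k w T T'} (h : update T k (w.reverse ++ T k) = T') : Exec (emit k w) T T' 1
  | seq {p q T₀ T₁ T₂ t₁ t₂} (h₁ : Exec p T₀ T₁ t₁) (h₂ : Exec q T₁ T₂ t₂) :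
      Exec (seq p q) T₀ T₂ (t₁ + t₂)
  | loop_nil {k p T} (h : T k = []) : Exec (loop k p) T T 1
  | loop_cons {k : K} {p T T₀ T₁ T₂ b l t₁ t₂} (h : T k = b :: l) (hT : update T k l = T₀)
      (h₁ : Exec (p b) T₀ T₁ t₁) (h₂ : Exec (loop k p) T₁ T₂ t₂) :
      Exec (loop k p) T T₂ (1 + t₁ + t₂)
  | while_nil {k p T} (h : T k = []) : Exec (whileTrue k p) T T 1
  | while_true {k p T T₀ T₁ T₂ l t₁ t₂} (h : T k = true :: l) (hT : update T k l = T₀)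
      (h₁ : Exec p T₀ T₁ t₁) (h₂ : Exec (whileTrue k p) T₁ T₂ t₂) :
      Exec (whileTrue k p) T T₂ (1 + t₁ + t₂)
  | while_false {k p T T' l} (h : T k = false :: l) (hT : update T k l = T') :
      Exec (whileTrue k p) T T' 1
  | mono {p T T' t t'} (h : Exec p T T' t) (ht : t ≤ t') : Exec p T T' t'

theorem length_update_tail_le {T : K → List Bool} {k : K} {b : Bool} {l : List Bool}
    (h : T k = b :: l) (j : K) : (update T k l j).length ≤ (T j).length := by
  rcases eq_or_ne j k with rfl | hj
  · simp [h]
  · simp [hj]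

theorem Exec.length_le {p : Prog K} {T T' : K → List Bool} {t : ℕ} (h : Exec p T T' t) (j : K)
    {w : ℕ} (hw : p.width ≤ w) : (T' j).length ≤ (T j).length + w * t := by
  induction h with
  | @emit k v T _ hT =>
    subst hT
    rcases eq_or_ne j k with rfl | hj
    · have : v.length ≤ w := hw
      simp only [update_self, List.length_append, List.length_reverse]
      omega
    · simp [hj]
  | seq _ _ ih₁ ih₂ =>
    have := ih₁ ((le_max_left _ _).trans hw)
    have := ih₂ ((le_max_right _ _).trans hw)
    rw [mul_add]; omega
  | loop_nil | while_nil => omega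
  | @loop_cons k p T _ T₁ _ b _ t₁ _ hk hT _ _ ih₁ ih₂ =>
    have := length_update_tail_le hk j
    have hb : (p b).width ≤ w := by
      cases b
      exacts [(le_max_left _ _).trans hw, (le_max_right _ _).trans hw]
    have := hT ▸ ih₁ hb
    have := ih₂ hw
    rw [mul_add, mul_add]; omega
  | while_true hk hT _ _ ih₁ ih₂ =>
    have := length_update_tail_le hk j
    have := hT ▸ ih₁ hw
    have := ih₂ hw
    rw [mul_add, mul_add]; omega
  | while_false hk hT =>
    have := length_update_tail_le hk j
    rw [← hT]; omega
  | mono _ ht ih => exact (ih hw).trans (by gcongr)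

section compile

variable {J Λ σ : Type} {Γ : J → Type} [DecidableEq J]

/-- The stack alphabets `Γ`, together with the alphabet of bits for the stacks in `K`. -/
@[reducible] def WithBits (Γ : J → Type) (K : Type) : J ⊕ K → Type
  | .inl j => Γ j
  | .inr _ => Bool

/-- The stacks `S` of a machine next to the stacks `T` of a program. -/
def joinStacks (S : ∀ j, List (Γ j)) (T : K → List Bool) : ∀ k, List (WithBits Γ K k) :=
  Sum.rec S T

theorem joinStacks_nil {J K : Type} {Γ : J → Type} :
    joinStacks (fun _ => []) (fun _ => []) = fun k => ([] : List (WithBits Γ K k)) :=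
  funext (Sum.rec (fun _ => rfl) fun _ => rfl)

theorem update_joinStacks_inl (S : ∀ j, List (Γ j)) (T : K → List Bool) (j : J) (l : List (Γ j)) :
    update (joinStacks S T) (.inl j) l = joinStacks (update S j l) T :=
  (Sum.rec_update_left (γ := fun k => List (WithBits Γ K k)) S T j l).symm

theorem update_joinStacks_inr (S : ∀ j, List (Γ j)) (T : K → List Bool) (k : K) (l : List Bool) :
    update (joinStacks S T) (.inr k) l = joinStacks S (update T k l) :=
  (Sum.rec_update_right (γ := fun k => List (WithBits Γ K k)) S T k l).symm

/-- The statement that pushes the letters of a word in order and goes to `next`. -/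
def emitStmt (k : K) (next : Λ) : List Bool → TM2.Stmt (WithBits Γ K) Λ (σ × Option Bool)
  | [] => .goto fun _ => next
  | b :: w => .push (.inr k) (fun _ => b) (emitStmt k next w)

/-- The statement that pops the stack `k` and goes to `l b` after popping `b`, or to `next` if the
stack is empty. -/
def popStmt (k : K) (l : Bool → Λ) (next : Λ) : TM2.Stmt (WithBits Γ K) Λ (σ × Option Bool) :=
  .pop (.inr k) (fun v o => (v.1, o)) (.goto fun v => v.2.elim next l)

/-- The statements of the compiled program, whose labels are embedded by `ι`; the program exits by
a jump to `next`. -/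
def compile : (p : Prog K) → (p.Label → Λ) → Λ → p.Label →
    TM2.Stmt (WithBits Γ K) Λ (σ × Option Bool)
  | emit k w, _, next, _ => emitStmt k next w
  | seq p q, ι, _, .inl l => p.compile (fun l => ι (.inl l)) (ι (.inr q.entry)) l
  | seq _ q, ι, next, .inr l => q.compile (fun l => ι (.inr l)) next l
  | loop k p, ι, next, none => popStmt k (fun b => ι (some ⟨b, (p b).entry⟩)) next
  | loop _ p, ι, _, some ⟨b, l⟩ => (p b).compile (fun l => ι (some ⟨b, l⟩)) (ι none) l
  | whileTrue k p, ι, next, none => popStmt k (fun b => cond b (ι (some p.entry)) next) next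
  | whileTrue _ p, ι, _, some l => p.compile (fun l => ι (some l)) (ι none) l

theorem stepAux_emitStmt (k : K) (next : Λ) (w : List Bool) (v : σ × Option Bool)
    (S : ∀ j, List (Γ j)) (T : K → List Bool) :
    TM2.stepAux (emitStmt k next w) v (joinStacks S T) =
      ⟨some next, v, joinStacks S (update T k (w.reverse ++ T k))⟩ := by
  induction w generalizing T with
  | nil => simp [emitStmt]
  | cons b w ih =>
    refine (congrArg _ (update_joinStacks_inr S T k (b :: T k))).trans ?_
    rw [ih]
    simp

theorem stepAux_popStmt (k : K) (l : Bool → Λ) (next : Λ) (v : σ × Option Bool)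
    (S : ∀ j, List (Γ j)) (T : K → List Bool) :
    TM2.stepAux (popStmt k l next) v (joinStacks S T) =
      ⟨some ((T k).head?.elim next l), (v.1, (T k).head?),
        joinStacks S (update T k (T k).tail)⟩ :=
  congrArg (TM2.Cfg.mk _ _) (update_joinStacks_inr S T k (T k).tail)

section

variable {m : Λ → TM2.Stmt (WithBits Γ K) Λ (σ × Option Bool)} {a next : Λ} {l : Bool → Λ}
  {k : K} {T : K → List Bool} (v : σ) (o : Option Bool) (S : ∀ j, List (Γ j))

theorem reachesWithin_popStmt_nil (hm : m a = popStmt k l next) (hk : T k = []) :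
    ReachesWithin (TM2.step m) 1 ⟨some a, (v, o), joinStacks S T⟩
      ⟨some next, (v, none), joinStacks S T⟩ := by
  refine .single ?_
  rw [TM2.step.eq_2, hm, stepAux_popStmt, hk, List.tail_nil, ← hk, update_eq_self, hk]
  rfl

theorem reachesWithin_popStmt_cons (hm : m a = popStmt k l next) {b : Bool} {w : List Bool}
    (hk : T k = b :: w) :
    ReachesWithin (TM2.step m) 1 ⟨some a, (v, o), joinStacks S T⟩
      ⟨some (l b), (v, some b), joinStacks S (update T k w)⟩ := by
  refine .single ?_
  rw [TM2.step.eq_2, hm, stepAux_popStmt, hk]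
  rfl

end

theorem Exec.reachesWithin {p : Prog K} {T T' : K → List Bool} {t : ℕ} (h : Exec p T T' t)
    (m : Λ → TM2.Stmt (WithBits Γ K) Λ (σ × Option Bool)) (S : ∀ j, List (Γ j))
    (ι : p.Label → Λ) (next : Λ) (hm : ∀ l, m (ι l) = p.compile ι next l) (v : σ)
    (o : Option Bool) :
    ∃ o', ReachesWithin (TM2.step m) t ⟨some (ι p.entry), (v, o), joinStacks S T⟩
      ⟨some next, (v, o'), joinStacks S T'⟩ := by
  induction h generalizing o next with
  | @emit k w T _ hT =>
    refine ⟨o, .single ?_⟩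
    rw [TM2.step.eq_2, hm, ← hT]
    exact congrArg some (stepAux_emitStmt k next w (v, o) S T)
  | @seq p q _ _ _ _ _ _ _ ih₁ ih₂ =>
    obtain ⟨o₁, h₁⟩ := ih₁ (fun l => ι (.inl l)) (ι (.inr q.entry)) (fun l => hm (.inl l)) o
    obtain ⟨o₂, h₂⟩ := ih₂ (fun l => ι (.inr l)) next (fun l => hm (.inr l)) o₁
    exact ⟨o₂, h₁.trans h₂⟩
  | loop_nil hk => exact ⟨none, reachesWithin_popStmt_nil v o S (hm none) hk⟩
  | @loop_cons k p _ _ _ _ b _ _ _ hk hT _ _ ih₁ ih₂ =>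
    obtain ⟨o₁, h₁⟩ := ih₁ (fun l => ι (some ⟨b, l⟩)) (ι none) (fun l => hm (some ⟨b, l⟩)) (some b)
    obtain ⟨o₂, h₂⟩ := ih₂ ι next hm o₁
    subst hT
    exact ⟨o₂, ((reachesWithin_popStmt_cons v o S (hm none) hk).trans h₁).trans h₂⟩
  | while_nil hk => exact ⟨none, reachesWithin_popStmt_nil v o S (hm none) hk⟩
  | while_true hk hT _ _ ih₁ ih₂ =>
    obtain ⟨o₁, h₁⟩ := ih₁ (fun l => ι (some l)) (ι none) (fun l => hm (some l)) (some true)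
    obtain ⟨o₂, h₂⟩ := ih₂ ι next hm o₁
    subst hT
    exact ⟨o₂, ((reachesWithin_popStmt_cons v o S (hm none) hk).trans h₁).trans h₂⟩
  | while_false hk hT =>
    subst hT
    exact ⟨some false, reachesWithin_popStmt_cons v o S (hm none) hk⟩
  | mono _ ht ih =>
    obtain ⟨o', h⟩ := ih ι next hm o
    exact ⟨o', h.mono ht⟩

end compile

end Prog

section Postcomposition

open Prog

variable {K : Type} [DecidableEq K] (tm : FinTM2) (p : Prog K) (e : tm.Γ tm.k₁ → Bool) (k k' : K)

/-- Labels of the machine that runs the program `p` on the output of `tm`: those of `tm`, a label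
`.inr (.inl false)` at which the output of `tm` is transferred to a stack of `p`, those of `p`, and
a label `.inr (.inl true)` at which the machine halts. -/
abbrev PostLabel : Type := tm.Λ ⊕ Bool ⊕ p.Label

/-- Statements of `tm` as statements of the larger machine; halting becomes a jump to the
transfer. -/
def liftStmt : TM2.Stmt tm.Γ tm.Λ tm.σ →
    TM2.Stmt (WithBits tm.Γ K) (PostLabel tm p) (tm.σ × Option Bool)
  | .push k f q => .push (.inl k) (fun v => f v.1) (liftStmt q)
  | .peek k f q => .peek (.inl k) (fun v o => (f v.1 o, v.2)) (liftStmt q)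
  | .pop k f q => .pop (.inl k) (fun v o => (f v.1 o, v.2)) (liftStmt q)
  | .load f q => .load (fun v => (f v.1, v.2)) (liftStmt q)
  | .branch f q₁ q₂ => .branch (fun v => f v.1) (liftStmt q₁) (liftStmt q₂)
  | .goto f => .goto fun v => .inl (f v.1)
  | .halt => .goto fun _ => .inr (.inl false)

/-- The statement that moves one letter of the output of `tm` to the stack `k`. -/
def transferStmt : TM2.Stmt (WithBits tm.Γ K) (PostLabel tm p) (tm.σ × Option Bool) :=
  .pop (.inl tm.k₁) (fun v o => (v.1, o.map e))
    (.branch (fun v => v.2.isSome)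
      (.push (.inr k) (fun v => v.2.getD false) (.goto fun _ => .inr (.inl false)))
      (.goto fun _ => .inr (.inr p.entry)))

/-- The machine that runs `tm`, transfers its output to the stack `k`, which reverses it, and then
runs the program `p`; the output of `p` is on the stack `k'`. -/
def postMachine [Fintype K] : FinTM2 where
  K := tm.K ⊕ K
  kDecidableEq := @instDecidableEqSum _ _ tm.kDecidableEq _
  kFin := @instFintypeSum _ _ tm.kFin _
  k₀ := .inl tm.k₀
  k₁ := .inr k'
  Γ := WithBits tm.Γ K
  Λ := PostLabel tm p
  main := .inl tm.main
  ΛFin := @instFintypeSum _ _ tm.ΛFin inferInstance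
  σ := tm.σ × Option Bool
  initialState := (tm.initialState, none)
  σFin := @instFintypeProd _ _ tm.σFin inferInstance
  Γk₀Fin := tm.Γk₀Fin
  m
    | .inl l => liftStmt tm p (tm.m l)
    | .inr (.inl false) => transferStmt tm p e k
    | .inr (.inl true) => .load (fun _ => (tm.initialState, none)) .halt
    | .inr (.inr l) => p.compile (fun l => .inr (.inr l)) (.inr (.inl true)) l

/-- Configurations of `tm` as configurations of the larger machine. -/
def liftCfg (c : TM2.Cfg tm.Γ tm.Λ tm.σ) :
    TM2.Cfg (WithBits tm.Γ K) (PostLabel tm p) (tm.σ × Option Bool) :=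
  ⟨some (c.l.elim (.inr (.inl false)) .inl), (c.var, none), joinStacks c.stk fun _ => []⟩

theorem stepAux_liftStmt (q : TM2.Stmt tm.Γ tm.Λ tm.σ) (v : tm.σ) (S : ∀ j, List (tm.Γ j)) :
    TM2.stepAux (liftStmt tm p q) (v, none) (joinStacks S fun _ => []) =
      liftCfg tm p (TM2.stepAux q v S) := by
  induction q generalizing v S with
  | push k f q ih => exact (congrArg _ (update_joinStacks_inl S _ k _)).trans (ih v _)
  | peek _ _ _ ih => exact ih _ _
  | pop k f q ih => exact (congrArg _ (update_joinStacks_inl S _ k _)).trans (ih _ _)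
  | load _ _ ih => exact ih _ _
  | branch f q₁ q₂ ih₁ ih₂ =>
    simp only [liftStmt, TM2.stepAux.eq_5]
    cases f v
    exacts [ih₂ _ _, ih₁ _ _]
  | goto | halt => rfl

theorem stepAux_transferStmt_nil (v : tm.σ × Option Bool) {S : ∀ j, List (tm.Γ j)}
    (T : K → List Bool) (h : S tm.k₁ = []) :
    TM2.stepAux (transferStmt tm p e k) v (joinStacks S T) =
      ⟨some (.inr (.inr p.entry)), (v.1, none), joinStacks S T⟩ := by
  have hS : update S tm.k₁ [] = S := by rw [← h, update_eq_self]
  have hj : joinStacks S T (.inl tm.k₁) = [] := h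
  simp only [transferStmt, TM2.stepAux.eq_3, TM2.stepAux.eq_5, TM2.stepAux.eq_6, hj,
    List.head?_nil, Option.map_none, Option.isSome_none, cond_false, List.tail_nil,
    update_joinStacks_inl, hS]

theorem stepAux_transferStmt_cons (v : tm.σ × Option Bool) {S : ∀ j, List (tm.Γ j)}
    (T : K → List Bool) {a : tm.Γ tm.k₁} {l : List (tm.Γ tm.k₁)} (h : S tm.k₁ = a :: l) :
    TM2.stepAux (transferStmt tm p e k) v (joinStacks S T) =
      ⟨some (.inr (.inl false)), (v.1, some (e a)),
        joinStacks (update S tm.k₁ l) (update T k (e a :: T k))⟩ := by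
  have hj : joinStacks S T (.inl tm.k₁) = a :: l := h
  simp only [transferStmt, TM2.stepAux.eq_3, TM2.stepAux.eq_5, TM2.stepAux.eq_6,
    TM2.stepAux.eq_1, hj, List.head?_cons, Option.map_some, Option.isSome_some,
    cond_true, List.tail_cons, update_joinStacks_inl, Option.getD_some, update_joinStacks_inr]
  rfl

theorem initList_eq (w : List (tm.Γ tm.k₀)) :
    initList tm w = ⟨some tm.main, tm.initialState, update (fun _ => []) tm.k₀ w⟩ := by
  refine congrArg (TM2.Cfg.mk _ _) (funext fun j => ?_)
  obtain rfl | hj := eq_or_ne j tm.k₀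
  · rw [update_self, dif_pos rfl]; rfl
  · rw [update_of_ne hj, dif_neg hj]

theorem haltList_eq (w : List (tm.Γ tm.k₁)) :
    haltList tm w = ⟨none, tm.initialState, update (fun _ => []) tm.k₁ w⟩ := by
  refine congrArg (TM2.Cfg.mk _ _) (funext fun j => ?_)
  obtain rfl | hj := eq_or_ne j tm.k₁
  · rw [update_self, dif_pos rfl]; rfl
  · rw [update_of_ne hj, dif_neg hj]

variable [Fintype K]

theorem reachesWithin_liftCfg {t : ℕ} {c c' : TM2.Cfg tm.Γ tm.Λ tm.σ}
    (h : ReachesWithin (TM2.step tm.m) t c c') :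
    ReachesWithin (TM2.step (postMachine tm p e k k').m) t (liftCfg tm p c) (liftCfg tm p c') := by
  induction h with
  | refl t c => exact .refl t _
  | @head t c d _ hcd _ ih =>
    refine .head ?_ ih
    obtain ⟨_ | l, v, S⟩ := c
    · cases hcd
    · rw [TM2.step.eq_2, Option.some.injEq] at hcd
      exact hcd ▸ congrArg some (stepAux_liftStmt tm p (tm.m l) v S)

theorem reachesWithin_transfer (v : tm.σ) (o : Option Bool) (l : List (tm.Γ tm.k₁))
    (S : ∀ j, List (tm.Γ j)) (T : K → List Bool) :
    ReachesWithin (TM2.step (postMachine tm p e k k').m) (l.length + 1)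
      ⟨some (.inr (.inl false)), (v, o), joinStacks (update S tm.k₁ l) T⟩
      ⟨some (.inr (.inr p.entry)), (v, none),
        joinStacks (update S tm.k₁ []) (update T k ((l.map e).reverse ++ T k))⟩ := by
  induction l generalizing o T with
  | nil =>
    refine .single (congrArg some ?_)
    rw [List.map_nil, List.reverse_nil, List.nil_append, update_eq_self]
    exact stepAux_transferStmt_nil tm p e k (v, o) T (update_self _ _ _)
  | cons a l ih =>
    have h := ih (some (e a)) (update T k (e a :: T k))
    simp only [update_self, update_idem] at h
    simp only [List.map_cons, List.reverse_cons, List.append_assoc, List.singleton_append]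
    refine h.head (congrArg some ?_)
    refine (stepAux_transferStmt_cons tm p e k (v, o) T (update_self _ _ _)).trans ?_
    rw [update_idem]
    rfl

theorem initList_postMachine (w : List (tm.Γ tm.k₀)) :
    initList (postMachine tm p e k k') w = liftCfg tm p (initList tm w) := by
  rw [initList_eq tm]
  refine (initList_eq (postMachine tm p e k k') w).trans (congrArg (TM2.Cfg.mk _ _) ?_)
  refine .trans ?_ (update_joinStacks_inl (fun _ => []) (fun _ => []) tm.k₀ w)
  rw [joinStacks_nil]
  rfl

theorem haltList_postMachine (r : List Bool) :
    haltList (postMachine tm p e k k') r = ⟨none, (tm.initialState, none),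
      joinStacks (fun _ => []) (update (fun _ => []) k' r)⟩ := by
  refine (haltList_eq (postMachine tm p e k k') r).trans (congrArg (TM2.Cfg.mk _ _) ?_)
  refine .trans ?_ (update_joinStacks_inr (fun _ => []) (fun _ => []) k' r)
  rw [joinStacks_nil]
  rfl

theorem reachesWithin_postMachine {w : List (tm.Γ tm.k₀)} {r : List (tm.Γ tm.k₁)} {r' : List Bool}
    {t t' : ℕ} (h : ReachesWithin tm.step t (initList tm w) (haltList tm r))
    (hp : p.Exec (update (fun _ => []) k (r.map e).reverse) (update (fun _ => []) k' r') t') :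
    ReachesWithin (postMachine tm p e k k').step (t + (r.length + 1) + t' + 1)
      (initList (postMachine tm p e k k') w) (haltList (postMachine tm p e k k') r') := by
  have h_run := reachesWithin_liftCfg tm p e k k' h
  rw [haltList_eq tm r] at h_run
  have h_transfer := reachesWithin_transfer tm p e k k' tm.initialState none r (fun _ => [])
    (fun _ => [])
  rw [List.append_nil, show update (fun _ => []) tm.k₁ [] = fun j => ([] : List (tm.Γ j)) from
    update_eq_self _ _] at h_transfer
  obtain ⟨o, h_prog⟩ := hp.reachesWithin (postMachine tm p e k k').m (fun _ => [])
    (fun l => .inr (.inr l)) (.inr (.inl true)) (fun _ => rfl) tm.initialState none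
  rw [initList_postMachine, haltList_postMachine]
  exact ((h_run.trans h_transfer).trans h_prog).trans (.single (congrArg some rfl))

end Postcomposition

section OutputLength

/-- The largest number of pushes along a branch of a statement. -/
def stmtPushes {K Λ σ : Type} {Γ : K → Type} : TM2.Stmt Γ Λ σ → ℕ
  | .push _ _ q => stmtPushes q + 1
  | .peek _ _ q => stmtPushes q
  | .pop _ _ q => stmtPushes q
  | .load _ q => stmtPushes q
  | .branch _ q₁ q₂ => max (stmtPushes q₁) (stmtPushes q₂)
  | .goto _ => 0
  | .halt => 0

variable {K Λ σ : Type} [DecidableEq K] {Γ : K → Type}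

theorem length_stepAux_le (q : TM2.Stmt Γ Λ σ) (v : σ) (S : ∀ k, List (Γ k)) (k : K) :
    ((TM2.stepAux q v S).stk k).length ≤ (S k).length + stmtPushes q := by
  induction q generalizing v S with
  | push j f q ih =>
    refine (ih v _).trans ?_
    obtain rfl | h := eq_or_ne k j
    · simp only [update_self, List.length_cons, stmtPushes]; omega
    · simp [update_of_ne h, stmtPushes]
  | peek _ _ _ ih => exact ih _ _
  | pop j f q ih =>
    refine (ih _ _).trans ?_
    obtain rfl | h := eq_or_ne k j
    · simp [stmtPushes]
    · simp [update_of_ne h, stmtPushes]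
  | load _ _ ih => exact ih _ _
  | branch f q₁ q₂ ih₁ ih₂ =>
    simp only [TM2.stepAux.eq_5, stmtPushes]
    cases f v
    · exact (ih₂ v S).trans (by simp)
    · exact (ih₁ v S).trans (by simp)
  | goto | halt => exact le_rfl

theorem ReachesWithin.length_le {m : Λ → TM2.Stmt Γ Λ σ} {c t : ℕ} (hc : ∀ l, stmtPushes (m l) ≤ c)
    {a b : TM2.Cfg Γ Λ σ} (h : ReachesWithin (TM2.step m) t a b) (k : K) :
    (b.stk k).length ≤ (a.stk k).length + c * t := by
  induction h with
  | refl => exact Nat.le_add_right _ _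
  | @head t a d _ had _ ih =>
    obtain ⟨_ | l, v, S⟩ := a
    · cases had
    · rw [TM2.step.eq_2, Option.some.injEq] at had
      have := had ▸ length_stepAux_le (m l) v S k
      have := hc l
      rw [mul_add, mul_one]
      change _ ≤ (S k).length + _
      omega

theorem exists_output_length_le (tm : FinTM2) : ∃ c : ℕ, ∀ (w : List (tm.Γ tm.k₀))
    (r : List (tm.Γ tm.k₁)) (t : ℕ), ReachesWithin tm.step t (initList tm w) (haltList tm r) →
      r.length ≤ w.length + c * t := by
  have := tm.ΛFin
  refine ⟨Finset.univ.sup fun l => stmtPushes (tm.m l), fun w r t h => ?_⟩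
  have hr := h.length_le
    (fun l => Finset.le_sup (f := fun l => stmtPushes (tm.m l)) (Finset.mem_univ l)) tm.k₁
  rw [initList_eq, haltList_eq] at hr
  simp only [update_self] at hr
  have hw (k : tm.K) : (update (fun j => ([] : List (tm.Γ j))) tm.k₀ w k).length ≤ w.length := by
    obtain rfl | hk := eq_or_ne k tm.k₀
    · simp
    · simp [update_of_ne hk]
  exact hr.trans (Nat.add_le_add_right (hw _) _)

end OutputLength

theorem exists_tm2ComputableInTime_of_exec {K α : Type} [DecidableEq K] [Finite K]
    {ea : α → List Bool} {f g : α → List Bool} (M : TM2ComputableInTime ea id f) (p : Prog K)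
    (k k' : K) : ∃ c : ℕ, (∀ a, (f a).length ≤ (ea a).length + c * M.time (ea a).length) ∧
      ∀ B : ℕ → ℕ, (∀ a, p.Exec (update (fun _ => []) k (f a).reverse)
        (update (fun _ => []) k' (g a)) (B (ea a).length)) →
      ∃ M' : TM2ComputableInTime ea id g, ∀ n, M'.time n =
        M.time n + (n + c * M.time n + 1) + B n + 1 := by
  cases nonempty_fintype K
  obtain ⟨c, hc⟩ := exists_output_length_le M.tm
  have hM (a : α) := ReachesWithin.of_evalsToInTime (M.outputsFun a)
  have hlen (a : α) : (f a).length ≤ (ea a).length + c * M.time (ea a).length := by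
    simpa using hc _ _ _ (hM a)
  refine ⟨c, hlen, fun B hB => ?_⟩
  have hM' (a : α) := (reachesWithin_postMachine M.tm p M.outputAlphabet k k' (hM a)
    (r' := g a) (t' := B (ea a).length) (by simpa [Function.comp_def] using hB a)).mono
      (t := M.time (ea a).length + ((ea a).length + c * M.time (ea a).length + 1) +
        B (ea a).length + 1) (by simpa using hlen a)
  refine ⟨⟨⟨postMachine M.tm p M.outputAlphabet k k', M.inputAlphabet, Equiv.refl Bool⟩, _,
    fun a => Classical.choice ?_⟩, fun n => rfl⟩
  have := (hM' a).nonempty_evalsToInTime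
  rwa [← List.map_id (g a)] at this

/-! ### Matrix elements of circuits -/

theorem exists_append_of_length_eq_add {α : Type*} {y : List α} {m n : ℕ}
    (h : y.length = m + n) : ∃ y₁ y₂, y = y₁ ++ y₂ ∧ y₁.length = m ∧ y₂.length = n :=
  ⟨y.take m, y.drop m, (List.take_append_drop _ _).symm, by rw [List.length_take]; omega,
    by rw [List.length_drop]; omega⟩

theorem exists_concat_of_length_eq_succ {α : Type*} {y : List α} {n : ℕ}
    (h : y.length = n + 1) : ∃ y' b, y = y' ++ [b] ∧ y'.length = n := by
  obtain ⟨y', z, rfl, h₁, h₂⟩ := exists_append_of_length_eq_add h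
  obtain ⟨b, rfl⟩ := List.length_eq_one_iff.1 h₂
  exact ⟨y', b, rfl, h₁⟩

theorem exists_cons_of_length_eq_succ {α : Type*} {y : List α} {n : ℕ}
    (h : y.length = n + 1) : ∃ b y', y = b :: y' ∧ y'.length = n := by
  obtain ⟨b, y', rfl⟩ := List.exists_cons_of_length_eq_add_one h
  exact ⟨b, y', rfl, Nat.succ.inj h⟩

/-- Strings of pairs of bits. The string `(x₁, x₁'), …, (xₙ, xₙ')` stands for the matrix unit
`|x⟩⟨x'|` on `n` qubits. The length is not part of the type, so that tensor products of matrix units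
are concatenations. -/
abbrev PairString : Type := List (Bool × Bool)

namespace PairString

/-- The row index of a matrix unit on `n` qubits. -/
def row (n : ℕ) (x : PairString) : Bits n := fun i => (x.getD i (false, false)).1

/-- The column index of a matrix unit on `n` qubits. -/
def col (n : ℕ) (x : PairString) : Bits n := fun i => (x.getD i (false, false)).2

theorem row_eq_and_col_eq_iff {n : ℕ} {x y : PairString} (hx : x.length = n) (hy : y.length = n) :
    row n x = row n y ∧ col n x = col n y ↔ x = y := by
  refine ⟨fun ⟨h₁, h₂⟩ => List.ext_getElem (hx.trans hy.symm) fun i hi hi' => ?_,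
    fun h => h ▸ ⟨rfl, rfl⟩⟩
  have h₁ := congrFun h₁ ⟨i, hx ▸ hi⟩
  have h₂ := congrFun h₂ ⟨i, hx ▸ hi⟩
  simp only [row, col, List.getD_eq_getElem _ _ hi, List.getD_eq_getElem _ _ hi'] at h₁ h₂
  exact Prod.ext h₁ h₂

theorem splitBits_row {a c : ℕ} {x x' : PairString} (hx : x.length = a) :
    splitBits a c (row (a + c) (x ++ x')) = (row a x, row c x') := by
  subst hx
  ext i <;> simp [splitBits, row, Equiv.sumArrowEquivProdArrow, Equiv.arrowCongr,
    List.getElem?_append]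

theorem splitBits_col {a c : ℕ} {x x' : PairString} (hx : x.length = a) :
    splitBits a c (col (a + c) (x ++ x')) = (col a x, col c x') := by
  subst hx
  ext i <;> simp [splitBits, col, Equiv.sumArrowEquivProdArrow, Equiv.arrowCongr,
    List.getElem?_append]

/-- The matrix units on `n` qubits. -/
def ofLength (n : ℕ) : Finset PairString :=
  Finset.univ.image fun f : Fin n → Bool × Bool => List.ofFn f

@[simp] theorem mem_ofLength {n : ℕ} {x : PairString} : x ∈ ofLength n ↔ x.length = n := by
  constructor
  · intro h
    obtain ⟨f, -, rfl⟩ := Finset.mem_image.1 h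
    exact List.length_ofFn
  · rintro rfl
    exact Finset.mem_image.2 ⟨x.get, Finset.mem_univ _, List.ofFn_get x⟩

section sum

variable {M : Type*} [AddCommMonoid M]

theorem sum_ofLength_zero (f : PairString → M) : ∑ x ∈ ofLength 0, f x = f [] := by
  rw [show ofLength 0 = {[]} by ext; simp, Finset.sum_singleton]

theorem sum_ofLength_one (f : PairString → M) : ∑ x ∈ ofLength 1, f x = ∑ a, f [a] := by
  refine (Finset.sum_bij (fun a _ => [a]) (by simp) (by simp) ?_ (by simp)).symm
  intro x hx
  obtain ⟨a, rfl⟩ := List.length_eq_one_iff.1 (mem_ofLength.1 hx)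
  exact ⟨a, Finset.mem_univ a, rfl⟩

theorem sum_ofLength_add (m n : ℕ) (f : PairString → M) :
    ∑ x ∈ ofLength (m + n), f x = ∑ y ∈ ofLength m, ∑ z ∈ ofLength n, f (y ++ z) := by
  rw [← Finset.sum_product']
  refine Finset.sum_bij' (fun x _ => (x.take m, x.drop m)) (fun p _ => p.1 ++ p.2) ?_ ?_ ?_ ?_ ?_
  · intro x hx
    simp [mem_ofLength.1 hx]
  · rintro ⟨y, z⟩ h
    simp only [Finset.mem_product, mem_ofLength] at h
    simp [h.1, h.2]
  · exact fun x _ => List.take_append_drop _ _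
  · rintro ⟨y, z⟩ h
    simp only [Finset.mem_product, mem_ofLength] at h
    simp [← h.1]
  · exact fun x _ => congrArg f (List.take_append_drop _ _).symm

theorem sum_ofLength_succ (n : ℕ) (f : PairString → M) :
    ∑ x ∈ ofLength (n + 1), f x = ∑ a, ∑ z ∈ ofLength n, f (a :: z) := by
  rw [add_comm, sum_ofLength_add, sum_ofLength_one]
  rfl

theorem sum_ofLength_row_col (n : ℕ) (f : Bits n → Bits n → M) :
    ∑ x ∈ ofLength n, f (row n x) (col n x) = ∑ i, ∑ j, f i j := by
  rw [ofLength, Finset.sum_image fun _ _ _ _ h => List.ofFn_injective h, ← Fintype.sum_prod_type']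
  refine Fintype.sum_equiv (Equiv.arrowProdEquivProdArrow (Fin n) (fun _ => Bool) (fun _ => Bool))
    _ _ fun q => ?_
  congr 1 <;> funext i <;> simp [row, col, Equiv.arrowProdEquivProdArrow]

end sum

end PairString

open PairString

section SuperOp

variable {a b c d : ℕ}

/-- The matrix elements of a linear map on operators: the coefficient of the matrix unit `y` in the
image of the matrix unit `x`. -/
def SuperOp.kernel (Φ : SuperOp a b) (x y : PairString) : ℂ :=
  Φ (Matrix.single (row a x) (col a x) 1) (row b y) (col b y)

theorem SuperOp.kernel_id {x y : PairString} (hx : x.length = a) (hy : y.length = a) :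
    kernel (LinearMap.id : SuperOp a a) x y = if x = y then 1 else 0 := by
  simp only [kernel, LinearMap.id_apply, Matrix.single_apply, row_eq_and_col_eq_iff hx hy]

theorem SuperOp.comp_single_apply (Φ : SuperOp a b) (Ψ : SuperOp b c) (i i' : Bits a)
    (y y' : Bits c) : (Ψ ∘ₗ Φ) (Matrix.single i i' 1) y y' =
      ∑ z, ∑ z', Φ (Matrix.single i i' 1) z z' * Ψ (Matrix.single z z' 1) y y' := by
  have single_eq (z z' : Bits b) (r : ℂ) :
      Matrix.single z z' r = r • Matrix.single z z' (1 : ℂ) := by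
    rw [Matrix.smul_single, smul_eq_mul, mul_one]
  rw [LinearMap.comp_apply]
  conv_lhs => rw [Matrix.matrix_eq_sum_single (Φ (Matrix.single i i' 1))]
  simp only [map_sum, Matrix.sum_apply]
  refine Finset.sum_congr rfl fun z _ => Finset.sum_congr rfl fun z' _ => ?_
  rw [single_eq, map_smul, Matrix.smul_apply, smul_eq_mul]

theorem SuperOp.kernel_comp (Φ : SuperOp a b) (Ψ : SuperOp b c) (x y : PairString) :
    kernel (Ψ ∘ₗ Φ) x y = ∑ z ∈ ofLength b, kernel Φ x z * kernel Ψ z y := by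
  simp only [kernel]
  rw [sum_ofLength_row_col b fun i j => Φ (Matrix.single (row a x) (col a x) 1) i j *
    Ψ (Matrix.single i j 1) (row c y) (col c y), comp_single_apply]

theorem operatorTensor_tmul_apply (A : Operator a) (B : Operator c) (y y' : Bits (a + c)) :
    operatorTensor a c (A ⊗ₜ[ℂ] B) y y' =
      A (splitBits a c y).1 (splitBits a c y').1 * B (splitBits a c y).2 (splitBits a c y').2 := by
  simp [operatorTensor]

theorem operatorTensor_single (i i' : Bits (a + c)) :
    operatorTensor a c (Matrix.single (splitBits a c i).1 (splitBits a c i').1 (1 : ℂ) ⊗ₜ[ℂ]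
      Matrix.single (splitBits a c i).2 (splitBits a c i').2 (1 : ℂ)) = Matrix.single i i' 1 := by
  have eq_iff (i y : Bits (a + c)) : i = y ↔ (splitBits a c i).1 = (splitBits a c y).1 ∧
      (splitBits a c i).2 = (splitBits a c y).2 := by
    rw [← Prod.ext_iff, (splitBits a c).injective.eq_iff]
  ext y y'
  rw [operatorTensor_tmul_apply]
  simp only [Matrix.single_apply]
  rw [ite_zero_mul_ite_zero, mul_one]
  refine if_congr ?_ rfl rfl
  rw [eq_iff i, eq_iff i', and_and_and_comm]

theorem SuperOp.tensor_single_apply (Φ : SuperOp a b) (Ψ : SuperOp c d) (i i' : Bits (a + c))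
    (y y' : Bits (b + d)) : SuperOp.tensor Φ Ψ (Matrix.single i i' 1) y y' =
      Φ (Matrix.single (splitBits a c i).1 (splitBits a c i').1 1)
        (splitBits b d y).1 (splitBits b d y').1 *
      Ψ (Matrix.single (splitBits a c i).2 (splitBits a c i').2 1)
        (splitBits b d y).2 (splitBits b d y').2 := by
  rw [← operatorTensor_single]
  simp [SuperOp.tensor, operatorTensor_tmul_apply]

theorem SuperOp.kernel_tensor (Φ : SuperOp a b) (Ψ : SuperOp c d) {x x' y y' : PairString}
    (hx : x.length = a) (hy : y.length = b) :
    kernel (SuperOp.tensor Φ Ψ) (x ++ x') (y ++ y') = kernel Φ x y * kernel Ψ x' y' := by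
  simp only [kernel, tensor_single_apply, splitBits_row hx, splitBits_col hx, splitBits_row hy,
    splitBits_col hy]

end SuperOp

section Layer

variable {G : GateSet}

theorem Layer.inputs_append (L M : Layer G) :
    Layer.inputs (L ++ M : Layer G) = Layer.inputs L + Layer.inputs M := by
  induction L with
  | nil => exact (Nat.zero_add _).symm
  | cons i L ih => exact (congrArg _ ih).trans (Nat.add_assoc _ _ _).symm

theorem Layer.outputs_append (L M : Layer G) :
    Layer.outputs (L ++ M : Layer G) = Layer.outputs L + Layer.outputs M := by
  induction L with
  | nil => exact (Nat.zero_add _).symm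
  | cons i L ih => exact (congrArg _ ih).trans (Nat.add_assoc _ _ _).symm

/-- The matrix elements of a layer. -/
def Layer.kernel (L : Layer G) (x y : PairString) : ℂ := SuperOp.kernel (Layer.channel L) x y

theorem Layer.kernel_nil : Layer.kernel ([] : Layer G) [] [] = 1 :=
  (SuperOp.kernel_id (a := 0) rfl rfl).trans (if_pos rfl)

theorem Layer.kernel_cons (i : Fin G.length) (L : Layer G) {x x' y y' : PairString}
    (hx : x.length = (G.get i).inputs) (hy : y.length = (G.get i).outputs) :
    Layer.kernel (i :: L : Layer G) (x ++ x') (y ++ y') =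
      (G.get i).channel.kernel x y * Layer.kernel L x' y' :=
  SuperOp.kernel_tensor _ _ hx hy

theorem Layer.kernel_singleton (i : Fin G.length) {x y : PairString}
    (hx : x.length = (G.get i).inputs) (hy : y.length = (G.get i).outputs) :
    Layer.kernel ([i] : Layer G) x y = (G.get i).channel.kernel x y := by
  have h := Layer.kernel_cons i [] (x' := []) (y' := []) hx hy
  rwa [List.append_nil, List.append_nil, Layer.kernel_nil, mul_one] at h

theorem Layer.kernel_append (L M : Layer G) {x x' y y' : PairString}
    (hx : x.length = Layer.inputs L) (hy : y.length = Layer.outputs L) :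
    Layer.kernel (L ++ M : Layer G) (x ++ x') (y ++ y') =
      Layer.kernel L x y * Layer.kernel M x' y' := by
  induction L generalizing x y with
  | nil =>
    obtain rfl := List.length_eq_zero_iff.1 hx
    obtain rfl := List.length_eq_zero_iff.1 hy
    rw [Layer.kernel_nil, one_mul]
    rfl
  | cons i L ih =>
    obtain ⟨x₁, x₂, rfl, hx₁, hx₂⟩ := exists_append_of_length_eq_add hx
    obtain ⟨y₁, y₂, rfl, hy₁, hy₂⟩ := exists_append_of_length_eq_add hy
    rw [List.append_assoc, List.append_assoc, List.cons_append, Layer.kernel_cons i _ hx₁ hy₁,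
      Layer.kernel_cons i _ hx₁ hy₁, ih hx₂ hy₂, mul_assoc]

/-- `Ls` is a sequence of composable layers from `a` qubits to `b` qubits. -/
inductive Composable : ℕ → List (Layer G) → ℕ → Prop
  | nil (a : ℕ) : Composable a [] a
  | cons {a b c : ℕ} {L : Layer G} {Ls : List (Layer G)} (ha : Layer.inputs L = a)
      (hb : Layer.outputs L = b) (h : Composable b Ls c) : Composable a (L :: Ls) c

variable {a b c : ℕ} {Ls Ms : List (Layer G)}

theorem Circuit.composable (C : Circuit G a b) : Composable a C.layers b := by
  induction C with
  | nil a => exact .nil a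
  | cons L C ih => exact .cons rfl rfl ih

theorem Composable.exists_circuit (h : Composable a Ls b) : ∃ C : Circuit G a b, C.layers = Ls := by
  induction h with
  | nil a => exact ⟨.nil a, rfl⟩
  | cons ha hb h ih =>
    obtain ⟨C, rfl⟩ := ih
    subst ha hb
    exact ⟨.cons _ C, rfl⟩

theorem Composable.append (h : Composable a Ls b) (h' : Composable b Ms c) :
    Composable a (Ls ++ Ms) c := by
  induction h with
  | nil a => exact h'
  | cons ha hb _ ih => exact .cons ha hb (ih h')

/-- The matrix elements of a sequence of layers. -/
def layersKernel : List (Layer G) → PairString → PairString → ℂ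
  | [], x, y => if x = y then 1 else 0
  | L :: Ls, x, y => ∑ z ∈ ofLength (Layer.outputs L), Layer.kernel L x z * layersKernel Ls z y

theorem Circuit.kernel_channel (C : Circuit G a b) {x y : PairString} (hx : x.length = a)
    (hy : y.length = b) : C.channel.kernel x y = layersKernel C.layers x y := by
  induction C generalizing x with
  | nil a => exact SuperOp.kernel_id hx hy
  | cons L C ih =>
    rw [Circuit.channel, SuperOp.kernel_comp, Circuit.layers, layersKernel]
    exact Finset.sum_congr rfl fun z hz => by rw [ih (mem_ofLength.1 hz) hy]; rfl

theorem layersKernel_singleton (L : Layer G) (x : PairString) {y : PairString}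
    (hy : y.length = Layer.outputs L) : layersKernel [L] x y = Layer.kernel L x y := by
  simp only [layersKernel, mul_ite, mul_one, mul_zero]
  rw [Finset.sum_ite_eq', if_pos (mem_ofLength.2 hy)]

theorem layersKernel_append (h : Composable a Ls b) (Ms : List (Layer G)) {x : PairString}
    (hx : x.length = a) (y : PairString) : layersKernel (Ls ++ Ms) x y =
      ∑ z ∈ ofLength b, layersKernel Ls x z * layersKernel Ms z y := by
  induction h generalizing x with
  | nil a =>
    simp only [layersKernel, List.nil_append, ite_mul, one_mul, zero_mul]
    rw [Finset.sum_ite_eq, if_pos (mem_ofLength.2 hx)]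
  | cons _ hb _ ih =>
    subst hb
    simp only [List.cons_append, layersKernel, Finset.sum_mul]
    rw [Finset.sum_comm]
    refine Finset.sum_congr rfl fun z hz => ?_
    rw [ih (mem_ofLength.1 hz), Finset.mul_sum]
    simp only [mul_assoc]

/-- The layer `L` maps the matrix unit `x` to the matrix unit `y`. -/
structure Layer.Maps (L : Layer G) (x y : PairString) : Prop where
  length_left : x.length = Layer.inputs L
  length_right : y.length = Layer.outputs L
  kernel_eq : ∀ z, z.length = Layer.outputs L → Layer.kernel L x z = if z = y then 1 else 0

theorem Layer.Maps.nil : Layer.Maps ([] : Layer G) [] [] where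
  length_left := rfl
  length_right := rfl
  kernel_eq z hz := by
    obtain rfl := List.length_eq_zero_iff.1 hz
    rw [Layer.kernel_nil, if_pos rfl]

theorem Layer.Maps.singleton {i : Fin G.length} {g : Gate} (hg : G.get i = g) {x y : PairString}
    (hx : x.length = g.inputs) (hy : y.length = g.outputs)
    (h : ∀ z, z.length = g.outputs → g.channel.kernel x z = if z = y then 1 else 0) :
    Layer.Maps [i] x y := by
  subst hg
  exact ⟨hx, hy, fun z hz => (Layer.kernel_singleton i hx hz).trans (h z hz)⟩

theorem Layer.Maps.append {L M : Layer G} {x y x' y' : PairString} (h : Layer.Maps L x y)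
    (h' : Layer.Maps M x' y') : Layer.Maps (L ++ M) (x ++ x') (y ++ y') where
  length_left := by rw [Layer.inputs_append, List.length_append, h.length_left, h'.length_left]
  length_right := by rw [Layer.outputs_append, List.length_append, h.length_right, h'.length_right]
  kernel_eq z hz := by
    rw [Layer.outputs_append] at hz
    obtain ⟨z₁, z₂, rfl, h₁, h₂⟩ := exists_append_of_length_eq_add hz
    rw [Layer.kernel_append L M h.length_left h₁, h.kernel_eq _ h₁, h'.kernel_eq _ h₂,
      ite_zero_mul_ite_zero, mul_one]
    refine if_congr ?_ rfl rfl
    rw [List.append_eq_append_iff_of_size_eq_left (h₁.trans h.length_right.symm)]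

theorem Layer.Maps.layersKernel_cons {L : Layer G} {x y : PairString} (h : Layer.Maps L x y)
    (Ls : List (Layer G)) (z : PairString) :
    layersKernel (L :: Ls) x z = layersKernel Ls y z := by
  rw [layersKernel, Finset.sum_eq_single_of_mem y (mem_ofLength.2 h.length_right)]
  · rw [h.kernel_eq _ h.length_right, if_pos rfl, one_mul]
  · intro w hw hne
    rw [h.kernel_eq _ (mem_ofLength.1 hw), if_neg hne, zero_mul]

end Layer

/-! ### Complete positivity and trace preservation -/

/-- Quantum channels, described by their values on the matrix units `|i⟩⟨i'|`: completely positive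
(there is a Kraus representation `L ↦ ∑ k, K k * L * (K k)†`) and trace-preserving. -/
structure IsChannel {a b : ℕ} (Φ : SuperOp a b) : Prop where
  exists_kraus : ∃ (ι : Type) (_ : Fintype ι) (K : ι → Bits b → Bits a → ℂ), ∀ i i' y y',
    Φ (Matrix.single i i' 1) y y' = ∑ k, K k y i * star (K k y' i')
  trace_eq : ∀ i i', ∑ y, Φ (Matrix.single i i' 1) y y = if i = i' then 1 else 0

namespace IsChannel

variable {a b c d : ℕ}

theorem of_kraus_single {Φ : SuperOp a b} (K : Bits b → Bits a → ℂ)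
    (h : ∀ i i' y y', Φ (Matrix.single i i' 1) y y' = K y i * star (K y' i'))
    (hK : ∀ i i', ∑ y, K y i * star (K y i') = if i = i' then 1 else 0) : IsChannel Φ where
  exists_kraus := ⟨Unit, inferInstance, fun _ => K, fun i i' y y' => by
    rw [h, Fintype.sum_unique]⟩
  trace_eq i i' := by simp only [h, hK]

theorem id (a : ℕ) : IsChannel (LinearMap.id : SuperOp a a) :=
  of_kraus_single (fun y i => if i = y then 1 else 0)
    (fun i i' y y' => by
      rw [LinearMap.id_apply, Matrix.single_apply, apply_ite star, star_one, star_zero,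
        ite_zero_mul_ite_zero, mul_one])
    (fun i i' => by simp)

theorem comp {Φ : SuperOp a b} {Ψ : SuperOp b c} (hΦ : IsChannel Φ) (hΨ : IsChannel Ψ) :
    IsChannel (Ψ ∘ₗ Φ) where
  exists_kraus := by
    obtain ⟨ι, _, K, hK⟩ := hΦ.exists_kraus
    obtain ⟨κ, _, L, hL⟩ := hΨ.exists_kraus
    refine ⟨ι × κ, inferInstance, fun p y i => ∑ z, K p.1 z i * L p.2 y z, fun i i' y y' => ?_⟩
    rw [SuperOp.comp_single_apply, Fintype.sum_prod_type]
    simp only [hK, hL, star_sum, Finset.sum_mul_sum, star_mul']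
    rw [Finset.sum_congr rfl fun z _ => Finset.sum_comm, Finset.sum_comm]
    refine Finset.sum_congr rfl fun k _ => ?_
    rw [Finset.sum_congr rfl fun z _ => Finset.sum_comm, Finset.sum_comm]
    refine Finset.sum_congr rfl fun l _ => Finset.sum_congr rfl fun z _ =>
      Finset.sum_congr rfl fun z' _ => ?_
    ring
  trace_eq i i' := by
    simp only [SuperOp.comp_single_apply]
    rw [Finset.sum_comm]
    simp_rw [Finset.sum_comm (s := Finset.univ (α := Bits c)), ← Finset.mul_sum, hΨ.trace_eq]
    simp [hΦ.trace_eq]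

theorem tensor {Φ : SuperOp a b} {Ψ : SuperOp c d} (hΦ : IsChannel Φ) (hΨ : IsChannel Ψ) :
    IsChannel (SuperOp.tensor Φ Ψ) where
  exists_kraus := by
    obtain ⟨ι, _, K, hK⟩ := hΦ.exists_kraus
    obtain ⟨κ, _, L, hL⟩ := hΨ.exists_kraus
    refine ⟨ι × κ, inferInstance, fun p y i => K p.1 (splitBits b d y).1 (splitBits a c i).1 *
      L p.2 (splitBits b d y).2 (splitBits a c i).2, fun i i' y y' => ?_⟩
    rw [SuperOp.tensor_single_apply, Fintype.sum_prod_type, hK, hL, Finset.sum_mul_sum]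
    refine Finset.sum_congr rfl fun k _ => Finset.sum_congr rfl fun l _ => ?_
    rw [star_mul']
    ring
  trace_eq i i' := by
    simp only [SuperOp.tensor_single_apply]
    rw [(splitBits b d).sum_comp fun p => Φ (Matrix.single (splitBits a c i).1 (splitBits a c i').1
      1) p.1 p.1 * Ψ (Matrix.single (splitBits a c i).2 (splitBits a c i').2 1) p.2 p.2,
      Fintype.sum_prod_type]
    dsimp only
    rw [← Finset.sum_mul_sum, hΦ.trace_eq, hΨ.trace_eq, ite_zero_mul_ite_zero, mul_one]
    refine if_congr ?_ rfl rfl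
    rw [← Prod.ext_iff, (splitBits a c).injective.eq_iff]

end IsChannel

theorem Gate.unitary_channel_single {k : ℕ} {U : Operator k} (hU halg) (i i' y y' : Bits k) :
    (Gate.unitary k U hU halg).channel (Matrix.single i i' 1) y y' = U y i * star (U y' i') := by
  simp [Gate.channel, Matrix.mul_apply, Matrix.single_apply, ite_and]

theorem Gate.prep_channel_single (i i' : Bits 0) (y y' : Bits 1) :
    Gate.prep.channel (Matrix.single i i' 1) y y' =
      if y = (fun _ => false) ∧ y' = (fun _ => false) then 1 else 0 := by
  obtain rfl : i = i' := Subsingleton.elim _ _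
  simp only [Gate.channel, LinearMap.smulRight_apply, Matrix.traceLinearMap_apply,
    Matrix.trace_single_eq_same, one_smul, ketbra, Matrix.single_apply]
  exact if_congr (and_congr eq_comm eq_comm) rfl rfl

theorem Gate.trace_channel_single (i i' : Bits 1) (y y' : Bits 0) :
    Gate.trace.channel (Matrix.single i i' 1) y y' = if i = i' then 1 else 0 := by
  have h : Gate.trace.channel (Matrix.single i i' 1) y y' =
      (Matrix.single i i' 1 : Operator 1).trace • (1 : Operator 0) y y' := rfl
  rw [h, Matrix.one_apply, if_pos (Subsingleton.elim _ _), smul_eq_mul, mul_one]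
  split_ifs with hi
  · rw [hi, Matrix.trace_single_eq_same]
  · exact Matrix.trace_single_eq_of_ne _ _ _ hi

theorem Gate.isChannel_channel (g : Gate) : IsChannel g.channel := by
  cases g with
  | unitary k U hU halg =>
    refine .of_kraus_single U (Gate.unitary_channel_single hU halg) fun i i' => ?_
    have hU' := congrFun (congrFun (Matrix.mem_unitaryGroup_iff'.1 hU) i') i
    rw [Matrix.mul_apply, Matrix.one_apply] at hU'
    rw [if_congr eq_comm rfl rfl, ← hU']
    exact Finset.sum_congr rfl fun y _ => by rw [Matrix.star_apply, mul_comm]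
  | prep =>
    refine .of_kraus_single (fun y _ => if y = (fun _ => false) then 1 else 0)
      (fun i i' y y' => ?_) fun i i' => ?_
    · rw [Gate.prep_channel_single, apply_ite star, star_one, star_zero, ite_zero_mul_ite_zero,
        mul_one]
    · simp [Subsingleton.elim i i']
  | trace =>
    refine ⟨⟨Bits 1, inferInstance, fun k _ i => if i = k then 1 else 0, fun i i' y y' => ?_⟩,
      fun i i' => ?_⟩
    · rw [Gate.trace_channel_single]
      simp [apply_ite (starRingEnd ℂ)]
    · exact (Fintype.sum_unique _).trans (Gate.trace_channel_single i i' _ _)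

section circuit

variable {G : GateSet} {a b m : ℕ}

theorem Layer.isChannel_channel (L : Layer G) : IsChannel (Layer.channel L) := by
  induction L with
  | nil => exact .id 0
  | cons i L ih => exact (Gate.isChannel_channel _).tensor ih

theorem Circuit.isChannel_channel (C : Circuit G a b) : IsChannel C.channel := by
  induction C with
  | nil a => exact .id a
  | cons L C ih => exact (Layer.isChannel_channel L).comp ih

theorem Circuit.prob_nonneg_and_channel_ketbra_apply (C : Circuit G a b) (x : Bits a)
    (y : Bits b) : 0 ≤ C.prob x y ∧ C.channel (ketbra x) y y = (C.prob x y : ℂ) := by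
  obtain ⟨ι, _, K, hK⟩ := C.isChannel_channel.exists_kraus
  have channel_eq : C.channel (ketbra x) y y = ((∑ k, Complex.normSq (K k y x) : ℝ) : ℂ) := by
    rw [ketbra, hK, Complex.ofReal_sum]
    exact Finset.sum_congr rfl fun k _ => Complex.mul_conj _
  have prob_eq : C.prob x y = ∑ k, Complex.normSq (K k y x) := by
    rw [Circuit.prob, channel_eq, Complex.ofReal_re]
  rw [channel_eq, prob_eq]
  exact ⟨Finset.sum_nonneg fun _ _ => Complex.normSq_nonneg _, rfl⟩

theorem Circuit.prob_nonneg (C : Circuit G a b) (x : Bits a) (y : Bits b) : 0 ≤ C.prob x y :=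
  (C.prob_nonneg_and_channel_ketbra_apply x y).1

theorem Circuit.channel_ketbra_apply (C : Circuit G a b) (x : Bits a) (y : Bits b) :
    C.channel (ketbra x) y y = (C.prob x y : ℂ) :=
  (C.prob_nonneg_and_channel_ketbra_apply x y).2

theorem Circuit.sum_prob (C : Circuit G a b) (x : Bits a) : ∑ y, C.prob x y = 1 := by
  have h : ∑ y, C.channel (ketbra x) y y = 1 :=
    (C.isChannel_channel.trace_eq x x).trans (if_pos rfl)
  simp only [C.channel_ketbra_apply] at h
  exact_mod_cast h

theorem acceptProb_nonneg (C : Circuit G m 1) (x : Bits m) : 0 ≤ acceptProb C x :=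
  C.prob_nonneg _ _

theorem prob_false_eq_one_sub_acceptProb (C : Circuit G m 1) (x : Bits m) :
    C.prob x (fun _ => false) = 1 - acceptProb C x := by
  have h := C.sum_prob x
  rw [← (Equiv.funUnique (Fin 1) Bool).symm.sum_comp, Fintype.sum_bool] at h
  exact eq_sub_of_add_eq' h

theorem acceptProb_le_one (C : Circuit G m 1) (x : Bits m) : acceptProb C x ≤ 1 :=
  sub_nonneg.1 (prob_false_eq_one_sub_acceptProb C x ▸ C.prob_nonneg x fun _ => false)

theorem sum_acceptProb (C : Circuit G m 1) : ∑ x, acceptProb C x = 2 ^ m * avgAcceptProb C := by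
  rw [avgAcceptProb, Fintype.expect_eq_sum_div_card]
  simp only [Fintype.card_pi, Fintype.card_bool, Finset.prod_const, Finset.card_univ,
    Fintype.card_fin, Nat.cast_pow, Nat.cast_ofNat]
  field_simp

theorem avgAcceptProb_nonneg (C : Circuit G m 1) : 0 ≤ avgAcceptProb C :=
  Finset.expect_nonneg fun x _ => acceptProb_nonneg C x

theorem avgAcceptProb_le_one (C : Circuit G m 1) : avgAcceptProb C ≤ 1 :=
  Finset.expect_le Finset.univ_nonempty fun x _ => acceptProb_le_one C x

end circuit

section diag

variable {n : ℕ}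

/-- The matrix units `|x⟩⟨x|`. -/
def PairString.IsDiag (x : PairString) : Prop := ∀ a ∈ x, a.1 = a.2

instance (x : PairString) : Decidable x.IsDiag :=
  inferInstanceAs (Decidable (∀ a ∈ x, a.1 = a.2))

/-- The matrix unit `|x⟩⟨x|` as a string of pairs. -/
def diag (x : Bits n) : PairString := List.ofFn fun i => (x i, x i)

@[simp] theorem length_diag (x : Bits n) : (diag x).length = n := List.length_ofFn

theorem diag_const (n : ℕ) (b : Bool) :
    diag (fun _ : Fin n => b) = List.replicate n (b, b) := List.ofFn_const _ _

@[simp] theorem row_diag (x : Bits n) : row n (diag x) = x := by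
  funext i
  simp [row, diag]

@[simp] theorem col_diag (x : Bits n) : col n (diag x) = x := by
  funext i
  simp [col, diag]

theorem diag_injective : Function.Injective (diag : Bits n → PairString) := fun x y h => by
  rw [← row_diag x, h, row_diag]

theorem isDiag_diag (x : Bits n) : (diag x).IsDiag := by
  intro a ha
  obtain ⟨i, rfl⟩ := (List.mem_ofFn' _ _).1 ha
  rfl

theorem PairString.IsDiag.diag_row {x : PairString} (h : x.IsDiag) (hx : x.length = n) :
    diag (row n x) = x := by
  rw [← row_eq_and_col_eq_iff (length_diag _) hx, row_diag, col_diag]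
  refine ⟨rfl, funext fun i => ?_⟩
  have hi : (i : ℕ) < x.length := hx ▸ i.2
  simp only [row, col, List.getD_eq_getElem _ _ hi]
  exact h _ (List.getElem_mem hi)

theorem sum_isDiag {M : Type*} [AddCommMonoid M] (f : PairString → M) :
    ∑ x ∈ ofLength n, (if x.IsDiag then f x else 0) = ∑ x : Bits n, f (diag x) := by
  rw [← Finset.sum_filter]
  refine (Finset.sum_bij (fun x _ => diag x) (fun x _ => ?_) (fun x _ y _ h => diag_injective h)
    (fun x hx => ?_) fun x _ => rfl).symm
  · simp [isDiag_diag]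
  · simp only [Finset.mem_filter, mem_ofLength] at hx
    exact ⟨row n x, Finset.mem_univ _, hx.2.diag_row hx.1⟩

theorem Circuit.layersKernel_diag {G : GateSet} {a b : ℕ} (C : Circuit G a b) (x : Bits a)
    (y : Bits b) : layersKernel C.layers (diag x) (diag y) = (C.prob x y : ℂ) := by
  rw [← C.channel_ketbra_apply x y, ← C.kernel_channel (length_diag x) (length_diag y),
    SuperOp.kernel, row_diag, row_diag, col_diag, col_diag, ketbra]

end diag

/-! ### Auxiliary gates -/

theorem Gate.kernel_unitary {k : ℕ} {U : Operator k} (hU halg) (x y : PairString) :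
    (Gate.unitary k U hU halg).channel.kernel x y =
      U (row k y) (row k x) * star (U (col k y) (col k x)) :=
  Gate.unitary_channel_single hU halg _ _ _ _

/-- The unitary gate that permutes the computational basis by `f`. -/
def permGate {k : ℕ} (f : Equiv.Perm (Bits k)) : Gate :=
  .unitary k (Matrix.of fun y x => if y = f x then 1 else 0)
    (by
      rw [Matrix.mem_unitaryGroup_iff']
      ext x x'
      simp [Matrix.mul_apply, Matrix.star_apply, Matrix.one_apply, eq_comm])
    (by
      intro x y
      simp only [Matrix.of_apply]
      split_ifs
      exacts [isAlgebraic_one, isAlgebraic_zero])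

theorem kernel_permGate {k : ℕ} (f : Equiv.Perm (Bits k)) {x y z : PairString}
    (hy : y.length = k) (hz : z.length = k) (hrow : row k y = f (row k x))
    (hcol : col k y = f (col k x)) :
    (permGate f).channel.kernel x z = if z = y then 1 else 0 := by
  rw [permGate, Gate.kernel_unitary]
  simp only [Matrix.of_apply, ← hrow, ← hcol, RCLike.star_def, apply_ite (starRingEnd ℂ),
    map_one, map_zero, ite_zero_mul_ite_zero, mul_one]
  exact if_congr (row_eq_and_col_eq_iff hz hy) rfl rfl

/-- `(x, a, b) ↦ (b, x, a)`. -/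
def rotPerm : Equiv.Perm (Bits 3) where
  toFun v := ![v 2, v 0, v 1]
  invFun v := ![v 1, v 2, v 0]
  left_inv := by decide
  right_inv := by decide

/-- `(c, x, a) ↦ (x, a, c)` if `c = 0`, and `(c, x, a) ↦ (a, x, c)` if `c = 1`. -/
def selPerm : Equiv.Perm (Bits 3) where
  toFun v := ![if v 0 then v 2 else v 1, if v 0 then v 1 else v 2, v 0]
  invFun v := ![v 2, if v 2 then v 1 else v 0, if v 2 then v 0 else v 1]
  left_inv := by decide
  right_inv := by decide

/-- The matrix of a unitary that maps `|00⟩` to the maximally entangled state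
`(|00⟩ + |11⟩) / √2`. -/
def bellMat : Operator 2 :=
  Matrix.of fun y x => if xor (y 0) (y 1) = x 1 then
    (if x 0 && y 0 then -1 else 1) * (Real.sqrt 2 : ℂ)⁻¹ else 0

theorem inv_sqrt_two_mul_self : (Real.sqrt 2 : ℂ)⁻¹ * (Real.sqrt 2 : ℂ)⁻¹ = 1 / 2 := by
  rw [← mul_inv, ← Complex.ofReal_mul, Real.mul_self_sqrt zero_le_two]
  norm_num

theorem isAlgebraic_inv_sqrt_two : IsAlgebraic ℚ (Real.sqrt 2 : ℂ)⁻¹ := by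
  refine (IsAlgebraic.of_pow two_pos ?_).inv
  rw [← Complex.ofReal_pow, Real.sq_sqrt zero_le_two]
  exact_mod_cast isAlgebraic_algebraMap (A := ℂ) (2 : ℚ)

theorem bellMat_mem_unitaryGroup : bellMat ∈ Matrix.unitaryGroup (Bits 2) ℂ := by
  rw [Matrix.mem_unitaryGroup_iff]
  ext y y'
  have eq_vec (v : Bits 2) : v = ![v 0, v 1] := by
    funext i
    fin_cases i <;> rfl
  rw [Matrix.mul_apply, ← (finTwoArrowEquiv Bool).symm.sum_comp, Fintype.sum_prod_type, eq_vec y,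
    eq_vec y']
  have h := inv_sqrt_two_mul_self
  cases y 0 <;> cases y 1 <;> cases y' 0 <;> cases y' 1 <;>
    simp [bellMat, Matrix.star_apply, h] <;> norm_num

/-- The gate that maps `|00⟩` to a maximally entangled state. -/
def bellGate : Gate :=
  .unitary 2 bellMat bellMat_mem_unitaryGroup fun x y => by
    simp only [bellMat, Matrix.of_apply]
    split_ifs
    · simpa using isAlgebraic_inv_sqrt_two.neg
    · simpa using isAlgebraic_inv_sqrt_two
    · exact isAlgebraic_zero

theorem row_three (p q r : Bool × Bool) : row 3 [p, q, r] = ![p.1, q.1, r.1] := by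
  funext i
  fin_cases i <;> rfl

theorem col_three (p q r : Bool × Bool) : col 3 [p, q, r] = ![p.2, q.2, r.2] := by
  funext i
  fin_cases i <;> rfl

theorem kernel_rotPerm (x a b : Bool × Bool) {z : PairString} (hz : z.length = 3) :
    (permGate rotPerm).channel.kernel [x, a, b] z = if z = [b, x, a] then 1 else 0 :=
  kernel_permGate _ rfl hz (by rw [row_three, row_three]; rfl) (by rw [col_three, col_three]; rfl)

/-- Choose `x` or `a` according to the control bit `c`, separately for rows and columns. -/
def select (c x a : Bool × Bool) : Bool × Bool :=
  (if c.1 then a.1 else x.1, if c.2 then a.2 else x.2)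

theorem kernel_selPerm (c x a : Bool × Bool) {z : PairString} (hz : z.length = 3) :
    (permGate selPerm).channel.kernel [c, x, a] z =
      if z = [select c x a, select c a x, c] then 1 else 0 :=
  kernel_permGate _ rfl hz (by rw [row_three, row_three]; rfl) (by rw [col_three, col_three]; rfl)

theorem kernel_prep {z : PairString} (hz : z.length = 1) :
    Gate.prep.channel.kernel [] z = if z = [(false, false)] then 1 else 0 := by
  refine (Gate.prep_channel_single _ _ _ _).trans (if_congr ?_ rfl rfl)
  rw [← row_eq_and_col_eq_iff hz rfl, ← List.replicate_one, ← diag_const, row_diag, col_diag]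

theorem kernel_trace (x : Bool × Bool) :
    Gate.trace.channel.kernel [x] [] = if x.1 = x.2 then 1 else 0 := by
  refine (Gate.trace_channel_single _ _ _ _).trans (if_congr ?_ rfl rfl)
  exact ⟨fun h => congrFun h 0, fun h => funext fun i => by fin_cases i; exact h⟩

theorem kernel_bellGate (a b : Bool × Bool) :
    bellGate.channel.kernel [(false, false), (false, false)] [a, b] =
      if a = b then 1 / 2 else 0 := by
  obtain ⟨a, a'⟩ := a
  obtain ⟨b, b'⟩ := b
  rw [bellGate, Gate.kernel_unitary]
  cases a <;> cases b <;> cases a' <;> cases b' <;>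
    simp [bellMat, row, col, inv_sqrt_two_mul_self]

/-- The gates that the sampling circuit uses in addition to those of the given circuit. -/
inductive AuxGate
  | id | prep | trace | bell | rot | sel

namespace AuxGate

/-- The elementary gate that an auxiliary gate stands for. -/
def gate : AuxGate → Gate
  | id => permGate (1 : Equiv.Perm (Bits 1))
  | prep => .prep
  | trace => .trace
  | bell => bellGate
  | rot => permGate rotPerm
  | sel => permGate selPerm

/-- The number of an auxiliary gate among the auxiliary gates. -/
def index : AuxGate → Fin 6
  | id => 0
  | prep => 1
  | trace => 2
  | bell => 3
  | rot => 4
  | sel => 5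

end AuxGate

/-- The gate set `G`, extended by the auxiliary gates. -/
def extGates (G : GateSet) : GateSet :=
  G ++ [AuxGate.id, .prep, .trace, .bell, .rot, .sel].map AuxGate.gate

theorem length_extGates (G : GateSet) : (extGates G).length = G.length + 6 := List.length_append

section extGates

variable (G : GateSet)

/-- The number of a gate of `G` in the extended gate set. -/
def oldGate (i : Fin G.length) : Fin (extGates G).length :=
  ⟨i, by rw [length_extGates]; omega⟩

/-- The number of an auxiliary gate in the extended gate set. -/
def auxGate (g : AuxGate) : Fin (extGates G).length :=
  ⟨G.length + g.index, by rw [length_extGates]; omega⟩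

theorem get_oldGate (i : Fin G.length) : (extGates G).get (oldGate G i) = G.get i := by
  simp [oldGate, extGates, List.getElem_append_left]

theorem get_auxGate (g : AuxGate) : (extGates G).get (auxGate G g) = g.gate := by
  simp only [auxGate, extGates, List.get_eq_getElem]
  rw [List.getElem_append_right (Nat.le_add_right _ _)]
  cases g <;> simp [AuxGate.index]

end extGates

/-! ### Layers of the sampling circuit -/

section rep

variable {α : Type*}

/-- The `m`-fold repetition of a word, used for words, for layers, and for sequences of layers. -/
def rep (m : ℕ) (w : List α) : List α := (List.replicate m w).flatten

@[simp] theorem rep_zero (w : List α) : rep 0 w = [] := rfl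

theorem rep_succ (m : ℕ) (w : List α) : rep (m + 1) w = w ++ rep m w := rfl

theorem rep_add (m n : ℕ) (w : List α) : rep (m + n) w = rep m w ++ rep n w := by
  rw [rep, List.replicate_add, List.flatten_append, rep, rep]

theorem rep_append_comm (m : ℕ) (w : List α) : rep m w ++ w = w ++ rep m w := by
  rw [← rep_succ, rep_add, rep_succ, rep_zero, List.append_nil]

theorem rep_append_self (m : ℕ) (w : List α) : rep m (w ++ w) = rep (2 * m) w := by
  induction m with
  | zero => rfl
  | succ m ih => rw [rep_succ, ih, mul_add, mul_one, rep_succ, rep_succ, List.append_assoc]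

variable {G : GateSet}

theorem Layer.inputs_rep (m : ℕ) (L : Layer G) :
    Layer.inputs (rep m L : Layer G) = m * Layer.inputs L := by
  induction m with
  | zero => exact (Nat.zero_mul _).symm
  | succ m ih => rw [rep_succ, Layer.inputs_append, ih, Nat.succ_mul, Nat.add_comm]

theorem Layer.outputs_rep (m : ℕ) (L : Layer G) :
    Layer.outputs (rep m L : Layer G) = m * Layer.outputs L := by
  induction m with
  | zero => exact (Nat.zero_mul _).symm
  | succ m ih => rw [rep_succ, Layer.outputs_append, ih, Nat.succ_mul, Nat.add_comm]

theorem Composable.rep {a : ℕ} {Ls : List (Layer G)} (h : Composable a Ls a) (t : ℕ) :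
    Composable a (rep t Ls) a := by
  induction t with
  | zero => exact .nil a
  | succ t ih => exact h.append ih

end rep

section auxGate

variable (G : GateSet)

/-- A layer of auxiliary gates. -/
def auxLayer (w : List AuxGate) : Layer (extGates G) := w.map (auxGate G)

theorem inputs_auxLayer (w : List AuxGate) :
    Layer.inputs (auxLayer G w) = (w.map fun g => g.gate.inputs).sum := by
  induction w with
  | nil => rfl
  | cons g w ih => exact congrArg₂ _ (by rw [get_auxGate]) ih

theorem outputs_auxLayer (w : List AuxGate) :
    Layer.outputs (auxLayer G w) = (w.map fun g => g.gate.outputs).sum := by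
  induction w with
  | nil => rfl
  | cons g w ih => exact congrArg₂ _ (by rw [get_auxGate]) ih

theorem kernel_auxLayer_singleton (g : AuxGate) {x y : PairString} (hx : x.length = g.gate.inputs)
    (hy : y.length = g.gate.outputs) :
    Layer.kernel (auxLayer G [g]) x y = g.gate.channel.kernel x y := by
  rw [← get_auxGate G g] at hx hy ⊢
  exact Layer.kernel_singleton _ hx hy

theorem maps_id (x : Bool × Bool) : Layer.Maps (auxLayer G [.id]) [x] [x] :=
  .singleton (get_auxGate G .id) rfl rfl fun _ hz => kernel_permGate 1 rfl hz rfl rfl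

theorem maps_prep : Layer.Maps (auxLayer G [.prep]) [] [(false, false)] :=
  .singleton (get_auxGate G .prep) rfl rfl fun _ hz => kernel_prep hz

theorem maps_rot (x a b : Bool × Bool) : Layer.Maps (auxLayer G [.rot]) [x, a, b] [b, x, a] :=
  .singleton (get_auxGate G .rot) rfl rfl fun _ hz => kernel_rotPerm x a b hz

theorem maps_sel (c x a : Bool × Bool) :
    Layer.Maps (auxLayer G [.sel]) [c, x, a] [select c x a, select c a x, c] :=
  .singleton (get_auxGate G .sel) rfl rfl fun _ hz => kernel_selPerm c x a hz

theorem maps_rep_id {k : ℕ} {x : PairString} (hx : x.length = k) :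
    Layer.Maps (rep k (auxLayer G [.id])) x x := by
  induction x generalizing k with
  | nil =>
    subst hx
    exact .nil
  | cons a x ih =>
    subst hx
    exact (maps_id G a).append (ih rfl)

theorem maps_rep_id_id {k : ℕ} {x : PairString} (hx : x.length = 2 * k) :
    Layer.Maps (rep k (auxLayer G [.id, .id])) x x := by
  have h := maps_rep_id G hx
  rwa [← rep_append_self] at h

theorem maps_rep_prep (m : ℕ) :
    Layer.Maps (rep m (auxLayer G [.prep])) [] (diag fun _ : Fin m => false) := by
  rw [diag_const]
  induction m with
  | zero => exact .nil
  | succ m ih => exact (maps_prep G).append ih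

theorem kernel_id_append (L : Layer (extGates G)) (x s : Bool × Bool) (y z : PairString) :
    Layer.kernel (auxLayer G [.id] ++ L : Layer (extGates G)) (x :: y) (s :: z) =
      if s = x then Layer.kernel L y z else 0 := by
  have hs : [s].length = Layer.outputs (auxLayer G [.id]) := (maps_id G x).length_right
  have h := Layer.kernel_append (auxLayer G [.id]) L (x' := y) (y' := z)
    (maps_id G x).length_left hs
  rw [(maps_id G x).kernel_eq _ hs, ite_mul, one_mul, zero_mul] at h
  exact h.trans (if_congr List.singleton_inj rfl rfl)

end auxGate

section oldGate

variable (G : GateSet)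

theorem inputs_map_oldGate (L : Layer G) :
    Layer.inputs (L.map (oldGate G) : Layer (extGates G)) = Layer.inputs L := by
  induction L with
  | nil => rfl
  | cons i L ih =>
    simp only [List.map_cons, Layer.inputs, get_oldGate]
    exact congrArg _ ih

theorem outputs_map_oldGate (L : Layer G) :
    Layer.outputs (L.map (oldGate G) : Layer (extGates G)) = Layer.outputs L := by
  induction L with
  | nil => rfl
  | cons i L ih =>
    simp only [List.map_cons, Layer.outputs, get_oldGate]
    exact congrArg _ ih

theorem kernel_map_oldGate (L : Layer G) {x y : PairString} (hx : x.length = Layer.inputs L)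
    (hy : y.length = Layer.outputs L) :
    Layer.kernel (L.map (oldGate G) : Layer (extGates G)) x y = Layer.kernel L x y := by
  induction L generalizing x y with
  | nil =>
    obtain rfl := List.length_eq_zero_iff.1 hx
    obtain rfl := List.length_eq_zero_iff.1 hy
    exact Layer.kernel_nil.trans Layer.kernel_nil.symm
  | cons i L ih =>
    obtain ⟨x₁, x₂, rfl, hx₁, hx₂⟩ := exists_append_of_length_eq_add hx
    obtain ⟨y₁, y₂, rfl, hy₁, hy₂⟩ := exists_append_of_length_eq_add hy
    rw [List.map_cons, Layer.kernel_cons i L hx₁ hy₁,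
      Layer.kernel_cons (oldGate G i) _ (by rw [get_oldGate, hx₁]) (by rw [get_oldGate, hy₁]),
      get_oldGate, ih hx₂ hy₂]

end oldGate

section interleave

variable {α : Type*}

/-- The list `x₁, a₁, b₁, x₂, a₂, b₂, …`. -/
def triples : List α → List α → List α → List α
  | x :: X, a :: A, b :: B => x :: a :: b :: triples X A B
  | _, _, _ => []

/-- The list `x₁, a₁, x₂, a₂, …`. -/
def pairs : List α → List α → List α
  | x :: X, a :: A => x :: a :: pairs X A
  | _, _ => []

theorem length_pairs {n : ℕ} {X A : List α} (hX : X.length = n) (hA : A.length = n) :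
    (pairs X A).length = 2 * n := by
  induction X generalizing A n with
  | nil =>
    subst hX
    rfl
  | cons x X ih =>
    subst hX
    obtain ⟨a, A, rfl, hA'⟩ := exists_cons_of_length_eq_succ hA
    rw [pairs, List.length_cons, List.length_cons, ih rfl hA', List.length_cons, Nat.mul_succ]

theorem pairs_concat {X A : List α} (h : X.length = A.length) (x a : α) :
    pairs (X ++ [x]) (A ++ [a]) = pairs X A ++ [x, a] := by
  induction X generalizing A with
  | nil =>
    obtain rfl := List.length_eq_zero_iff.1 h.symm
    rfl
  | cons y X ih =>
    obtain ⟨b, A, rfl, hA⟩ := exists_cons_of_length_eq_succ h.symm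
    simp only [List.cons_append, pairs, ih hA.symm]

theorem zipWith_eq_left {f : α → α → α} (hf : ∀ x a, f x a = x) {X A : List α}
    (h : X.length = A.length) : List.zipWith f X A = X := by
  refine List.ext_getElem (by simp [h]) fun i _ _ => ?_
  rw [List.getElem_zipWith, hf]

theorem zipWith_eq_right {f : α → α → α} (hf : ∀ x a, f x a = a) {X A : List α}
    (h : X.length = A.length) : List.zipWith f X A = A := by
  refine List.ext_getElem (by simp [h]) fun i _ _ => ?_
  rw [List.getElem_zipWith, hf]

end interleave

section layers

variable (G : GateSet)

/-- The first layer of a round: two new qubits after each qubit. -/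
def prepLayer (m : ℕ) : Layer (extGates G) := rep m (auxLayer G [.id, .prep, .prep])

/-- The second layer of a round: entangle the two new qubits of each triple, so that one of them
becomes a uniformly random bit and the other one a record of it. -/
def bellLayer (m : ℕ) : Layer (extGates G) := rep m (auxLayer G [.id, .bell])

/-- One of the layers that move the last qubit of each triple to the front. -/
def rotLayer (k j : ℕ) : Layer (extGates G) :=
  rep k (auxLayer G [.id]) ++ rep j (auxLayer G [.rot]) ++ rep k (auxLayer G [.id, .id])

/-- The layers that move the last qubit of each triple to the front: after `k` layers, `k` of these
qubits are at the front, followed by `j` triples and by the other qubits of the last `k` triples. -/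
def rotLayers : ℕ → ℕ → List (Layer (extGates G))
  | _, 0 => []
  | k, j + 1 => rotLayer G k (j + 1) :: rotLayers (k + 1) j

/-- One of the layers that swap the members of each pair if the control qubit is set. -/
def selLayer (k j : ℕ) : Layer (extGates G) :=
  rep k (auxLayer G [.id, .id]) ++ auxLayer G [.sel] ++ rep j (auxLayer G [.id, .id])

/-- The layers that swap the members of each pair if the control qubit is set: it has passed `k`
pairs, and `j` pairs remain. -/
def selLayers : ℕ → ℕ → List (Layer (extGates G))
  | _, 0 => []
  | k, j + 1 => selLayer G k j :: selLayers (k + 1) j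

/-- The last layer of a round: discard the second members of the pairs and the control qubit. -/
def discardLayer (m : ℕ) : Layer (extGates G) :=
  rep m (auxLayer G [.id, .trace]) ++ auxLayer G [.trace]

variable {G}

/-- The layers of a circuit over `G`, with the identity on `2 * m` further qubits. -/
def copyLayers (m : ℕ) (Ls : List (Layer G)) : List (Layer (extGates G)) :=
  Ls.map fun L => L.map (oldGate G) ++ rep m (auxLayer G [.id, .id])

/-- One round: draw a uniformly random string, run the circuit on it, and replace the present
string by the random one if the circuit accepts. -/
def roundLayers (m : ℕ) (Ls : List (Layer G)) : List (Layer (extGates G)) :=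
  [prepLayer G m, bellLayer G m] ++ (rotLayers G 0 m ++ (copyLayers m Ls ++ (selLayers G 0 m ++
    [discardLayer G m])))

/-- The layers of the sampling circuit: start with the string `0…0` and perform `2 ^ m` rounds. -/
def sampleLayers (m : ℕ) (Ls : List (Layer G)) : List (Layer (extGates G)) :=
  rep m (auxLayer G [.prep]) :: rep (2 ^ m) (roundLayers m Ls)

end layers

section composable

variable (G : GateSet)

theorem inputs_prepLayer (m : ℕ) : Layer.inputs (prepLayer G m) = m := by
  simp only [prepLayer, Layer.inputs_rep, inputs_auxLayer]
  change m * 1 = m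
  omega

theorem outputs_prepLayer (m : ℕ) : Layer.outputs (prepLayer G m) = 3 * m := by
  simp only [prepLayer, Layer.outputs_rep, outputs_auxLayer]
  change m * 3 = 3 * m
  omega

theorem inputs_bellLayer (m : ℕ) : Layer.inputs (bellLayer G m) = 3 * m := by
  simp only [bellLayer, Layer.inputs_rep, inputs_auxLayer]
  change m * 3 = 3 * m
  omega

theorem outputs_bellLayer (m : ℕ) : Layer.outputs (bellLayer G m) = 3 * m := by
  simp only [bellLayer, Layer.outputs_rep, outputs_auxLayer]
  change m * 3 = 3 * m
  omega

theorem inputs_rotLayer (k j : ℕ) : Layer.inputs (rotLayer G k j) = 3 * (k + j) := by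
  simp only [rotLayer, Layer.inputs_append, Layer.inputs_rep, inputs_auxLayer]
  change k * 1 + j * 3 + k * 2 = 3 * (k + j)
  omega

theorem outputs_rotLayer (k j : ℕ) : Layer.outputs (rotLayer G k j) = 3 * (k + j) := by
  simp only [rotLayer, Layer.outputs_append, Layer.outputs_rep, outputs_auxLayer]
  change k * 1 + j * 3 + k * 2 = 3 * (k + j)
  omega

theorem inputs_selLayer (k j : ℕ) : Layer.inputs (selLayer G k j) = 1 + 2 * (k + (j + 1)) := by
  simp only [selLayer, Layer.inputs_append, Layer.inputs_rep, inputs_auxLayer]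
  change k * 2 + 3 + j * 2 = 1 + 2 * (k + (j + 1))
  omega

theorem outputs_selLayer (k j : ℕ) : Layer.outputs (selLayer G k j) = 1 + 2 * (k + (j + 1)) := by
  simp only [selLayer, Layer.outputs_append, Layer.outputs_rep, outputs_auxLayer]
  change k * 2 + 3 + j * 2 = 1 + 2 * (k + (j + 1))
  omega

theorem inputs_discardLayer (m : ℕ) : Layer.inputs (discardLayer G m) = 1 + 2 * m := by
  simp only [discardLayer, Layer.inputs_append, Layer.inputs_rep, inputs_auxLayer]
  change m * 2 + 1 = 1 + 2 * m
  omega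

theorem outputs_discardLayer (m : ℕ) : Layer.outputs (discardLayer G m) = m := by
  simp only [discardLayer, Layer.outputs_append, Layer.outputs_rep, outputs_auxLayer]
  change m * 1 + 0 = m
  omega

theorem composable_rotLayers {m : ℕ} (k j : ℕ) (h : k + j = m) :
    Composable (3 * m) (rotLayers G k j) (3 * m) := by
  induction j generalizing k with
  | zero => exact .nil _
  | succ j ih =>
    exact .cons (by rw [inputs_rotLayer, h]) (by rw [outputs_rotLayer, h]) (ih (k + 1) (by omega))

theorem composable_selLayers {m : ℕ} (k j : ℕ) (h : k + j = m) :
    Composable (1 + 2 * m) (selLayers G k j) (1 + 2 * m) := by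
  induction j generalizing k with
  | zero => exact .nil _
  | succ j ih =>
    exact .cons (by rw [inputs_selLayer, h]) (by rw [outputs_selLayer, h]) (ih (k + 1) (by omega))

variable {G} {m : ℕ} {Ls : List (Layer G)}

theorem composable_copyLayers {a b : ℕ} (m : ℕ) (h : Composable a Ls b) :
    Composable (a + 2 * m) (copyLayers m Ls) (b + 2 * m) := by
  have hid := maps_rep_id_id G (k := m) (x := List.replicate (2 * m) (false, false))
    List.length_replicate
  induction h with
  | nil a => exact .nil _
  | cons ha hb _ ih =>
    refine .cons ?_ ?_ ih
    · rw [Layer.inputs_append, inputs_map_oldGate, ← hid.length_left, List.length_replicate, ha]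
    · rw [Layer.outputs_append, outputs_map_oldGate, ← hid.length_right, List.length_replicate, hb]

theorem composable_roundLayers (h : Composable m Ls 1) : Composable m (roundLayers m Ls) m := by
  have hcopy := composable_copyLayers m h
  rw [show m + 2 * m = 3 * m by ring] at hcopy
  exact .cons (inputs_prepLayer G m) (outputs_prepLayer G m) <|
    .cons (inputs_bellLayer G m) (outputs_bellLayer G m) <|
    (composable_rotLayers G 0 m (zero_add m)).append <| hcopy.append <|
    (composable_selLayers G 0 m (zero_add m)).append <|
    .cons (inputs_discardLayer G m) (outputs_discardLayer G m) (.nil m)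

theorem composable_sampleLayers (h : Composable m Ls 1) : Composable 0 (sampleLayers m Ls) m :=
  .cons (maps_rep_prep G m).length_left.symm
    ((maps_rep_prep G m).length_right.symm.trans (length_diag _))
    ((composable_roundLayers h).rep _)

end composable

/-! ### One round of the sampling circuit -/

section round

variable (G : GateSet) {m : ℕ}

theorem maps_prepLayer {X : PairString} (hX : X.length = m) :
    Layer.Maps (prepLayer G m) X
      (triples X (List.replicate m (false, false)) (List.replicate m (false, false))) := by
  induction X generalizing m with
  | nil =>
    subst hX
    exact .nil
  | cons x X ih =>
    subst hX
    exact ((maps_id G x).append ((maps_prep G).append (maps_prep G))).append (ih rfl)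

theorem kernel_bellLayer_succ (x z a b : Bool × Bool) (X Z : PairString) :
    Layer.kernel (bellLayer G (m + 1)) (x :: (false, false) :: (false, false) :: X)
        (z :: a :: b :: Z) =
      if z = x ∧ a = b then 1 / 2 * Layer.kernel (bellLayer G m) X Z else 0 := by
  have hbell := Layer.kernel_append (auxLayer G [.bell]) (bellLayer G m)
    (x := [(false, false), (false, false)]) (y := [a, b]) (x' := X) (y' := Z)
    (inputs_auxLayer G [.bell]).symm (outputs_auxLayer G [.bell]).symm
  rw [kernel_auxLayer_singleton G .bell rfl rfl, AuxGate.gate, kernel_bellGate] at hbell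
  refine (kernel_id_append G _ x z _ _).trans ?_
  rw [ite_and]
  refine if_congr Iff.rfl (hbell.trans ?_) rfl
  rw [ite_zero_mul]

theorem sum_kernel_bellLayer_mul {X : PairString} (hX : X.length = m) (f : PairString → ℂ) :
    ∑ z ∈ ofLength (3 * m), Layer.kernel (bellLayer G m)
        (triples X (List.replicate m (false, false)) (List.replicate m (false, false))) z * f z =
      (1 / 2) ^ m * ∑ A ∈ ofLength m, f (triples X A A) := by
  induction X generalizing m f with
  | nil =>
    subst hX
    rw [List.length_nil, mul_zero, sum_ofLength_zero, sum_ofLength_zero, pow_zero]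
    exact congrArg (· * f []) Layer.kernel_nil
  | cons x X ih =>
    subst hX
    rw [List.length_cons, mul_add, mul_one]
    simp only [sum_ofLength_succ, List.replicate_succ, triples, kernel_bellLayer_succ, ite_and,
      ite_mul, zero_mul, Finset.sum_ite_irrel, Finset.sum_const_zero, Finset.sum_ite_eq,
      Finset.sum_ite_eq', Finset.mem_univ, if_true, mul_assoc, ← Finset.mul_sum]
    rw [Finset.mul_sum, Finset.mul_sum]
    refine Finset.sum_congr rfl fun a _ => ?_
    rw [ih rfl fun Z => f (x :: a :: a :: Z), pow_succ', mul_assoc]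

theorem maps_rots {n : ℕ} {X A B : PairString} (hX : X.length = n) (hA : A.length = n)
    (hB : B.length = n) (b x a : Bool × Bool) :
    Layer.Maps (rep (n + 1) (auxLayer G [.rot])) (triples (X ++ [x]) (A ++ [a]) (b :: B))
      (b :: (triples X A B ++ [x, a])) := by
  induction X generalizing n A B b with
  | nil =>
    subst hX
    obtain rfl := List.length_eq_zero_iff.1 hA
    obtain rfl := List.length_eq_zero_iff.1 hB
    exact maps_rot G x a b
  | cons x₁ X ih =>
    subst hX
    obtain ⟨a₁, A, rfl, hA'⟩ := exists_cons_of_length_eq_succ hA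
    obtain ⟨b₁, B, rfl, hB'⟩ := exists_cons_of_length_eq_succ hB
    exact (maps_rot G x₁ a₁ b).append (ih rfl hA' hB' b₁)

theorem layersKernel_rotLayers {j k : ℕ} {P X A B S : PairString} (hP : P.length = k)
    (hX : X.length = j) (hA : A.length = j) (hB : B.length = j) (hS : S.length = 2 * k)
    (Ls : List (Layer (extGates G))) (y : PairString) :
    layersKernel (rotLayers G k j ++ Ls) (P ++ triples X A B ++ S) y =
      layersKernel Ls (P ++ B ++ (pairs X A ++ S)) y := by
  induction j generalizing k P X A B S with
  | zero =>
    obtain rfl := List.length_eq_zero_iff.1 hX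
    obtain rfl := List.length_eq_zero_iff.1 hA
    obtain rfl := List.length_eq_zero_iff.1 hB
    simp only [rotLayers, triples, pairs, List.nil_append, List.append_nil]
  | succ j ih =>
    obtain ⟨X, x, rfl, hX'⟩ := exists_concat_of_length_eq_succ hX
    obtain ⟨A, a, rfl, hA'⟩ := exists_concat_of_length_eq_succ hA
    obtain ⟨b, B, rfl, hB'⟩ := exists_cons_of_length_eq_succ hB
    have first : Layer.Maps (rotLayer G k (j + 1))
        (P ++ triples (X ++ [x]) (A ++ [a]) (b :: B) ++ S)
        (P ++ (b :: (triples X A B ++ [x, a])) ++ S) :=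
      ((maps_rep_id G hP).append (maps_rots G hX' hA' hB' b x a)).append (maps_rep_id_id G hS)
    have rest := ih (k := k + 1) (P := P ++ [b]) (S := [x, a] ++ S)
      (by rw [List.length_append, hP, List.length_singleton]) hX' hA' hB'
      (by rw [List.length_append, hS, mul_add, add_comm]; rfl)
    rw [rotLayers, List.cons_append, first.layersKernel_cons, pairs_concat (hX'.trans hA'.symm)]
    simpa only [List.append_assoc, List.cons_append, List.nil_append] using rest

theorem layersKernel_selLayers {j k : ℕ} {P X A : PairString} (hP : P.length = 2 * k)
    (hX : X.length = j) (hA : A.length = j) (c : Bool × Bool)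
    (Ls : List (Layer (extGates G))) (y : PairString) :
    layersKernel (selLayers G k j ++ Ls) (P ++ c :: pairs X A) y =
      layersKernel Ls
        (P ++ (pairs (List.zipWith (select c) X A) (List.zipWith (select c) A X) ++ [c])) y := by
  induction j generalizing k P X A with
  | zero =>
    obtain rfl := List.length_eq_zero_iff.1 hX
    obtain rfl := List.length_eq_zero_iff.1 hA
    rfl
  | succ j ih =>
    obtain ⟨x, X, rfl, hX'⟩ := exists_cons_of_length_eq_succ hX
    obtain ⟨a, A, rfl, hA'⟩ := exists_cons_of_length_eq_succ hA
    have first : Layer.Maps (selLayer G k j) (P ++ [c, x, a] ++ pairs X A)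
        (P ++ [select c x a, select c a x, c] ++ pairs X A) :=
      ((maps_rep_id_id G hP).append (maps_sel G c x a)).append
        (maps_rep_id_id G (length_pairs hX' hA'))
    have rest := ih (k := k + 1) (P := P ++ [select c x a, select c a x])
      (by rw [List.length_append, hP, mul_add]; rfl) hX' hA'
    simp only [selLayers, List.cons_append, pairs, List.zipWith_cons_cons, List.append_assoc,
      List.nil_append] at first rest ⊢
    rw [first.layersKernel_cons, rest]

theorem kernel_discardLayer {X A S : PairString} (hX : X.length = m) (hA : A.length = m)
    (hS : S.length = m) (c : Bool × Bool) :
    Layer.kernel (discardLayer G m) (pairs X A ++ [c]) S =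
      if S = X ∧ A.IsDiag ∧ c.1 = c.2 then 1 else 0 := by
  have kernel_trace (x : Bool × Bool) :
      Layer.kernel (auxLayer G [.trace]) [x] [] = if x.1 = x.2 then 1 else 0 :=
    (kernel_auxLayer_singleton G .trace rfl rfl).trans (kernel_trace x)
  induction X generalizing m A S with
  | nil =>
    subst hX
    obtain rfl := List.length_eq_zero_iff.1 hA
    obtain rfl := List.length_eq_zero_iff.1 hS
    refine (kernel_trace c).trans (if_congr ?_ rfl rfl)
    simp [IsDiag]
  | cons x X ih =>
    subst hX
    obtain ⟨a, A, rfl, hA'⟩ := exists_cons_of_length_eq_succ hA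
    obtain ⟨s, S, rfl, hS'⟩ := exists_cons_of_length_eq_succ hS
    have htrace := Layer.kernel_append (auxLayer G [.trace]) (discardLayer G X.length)
      (x := [a]) (y := []) (x' := pairs X A ++ [c]) (y' := S)
      (inputs_auxLayer G [.trace]).symm (outputs_auxLayer G [.trace]).symm
    rw [kernel_trace, ih rfl hA' hS', ite_zero_mul_ite_zero, mul_one] at htrace
    refine (kernel_id_append G _ x s _ _).trans ?_
    refine (if_congr Iff.rfl htrace rfl).trans ?_
    rw [← ite_and]
    refine if_congr ?_ rfl rfl
    simp only [List.cons.injEq, IsDiag, List.forall_mem_cons]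
    tauto

theorem layersKernel_selLayers_discardLayer {X A S : PairString} (hX : X.length = m)
    (hA : A.length = m) (hS : S.length = m) (c : Bool × Bool) :
    layersKernel (selLayers G 0 m ++ [discardLayer G m]) (c :: pairs X A) S =
      if S = List.zipWith (select c) X A ∧ IsDiag (List.zipWith (select c) A X) ∧ c.1 = c.2
        then 1 else 0 := by
  have hsel := layersKernel_selLayers G (k := 0) (P := []) rfl hX hA c [discardLayer G m] S
  rw [List.nil_append, List.nil_append] at hsel
  rw [hsel, layersKernel_singleton _ _ (by rw [hS, outputs_discardLayer]),
    kernel_discardLayer G (by rw [List.length_zipWith, hX, hA, min_self])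
      (by rw [List.length_zipWith, hX, hA, min_self]) hS]

variable {G} {Ls : List (Layer G)}

theorem layersKernel_copyLayers {a b : ℕ} (h : Composable a Ls b) {A U : PairString}
    (hA : A.length = a) (hU : U.length = 2 * m) (Ms : List (Layer (extGates G)))
    (y : PairString) :
    layersKernel (copyLayers m Ls ++ Ms) (A ++ U) y =
      ∑ c ∈ ofLength b, layersKernel Ls A c * layersKernel Ms (c ++ U) y := by
  induction h generalizing A with
  | nil a =>
    simp only [layersKernel, copyLayers, List.map_nil, List.nil_append, ite_mul, one_mul, zero_mul]
    rw [Finset.sum_ite_eq, if_pos (mem_ofLength.2 hA)]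
  | @cons a b c L Ls ha hb _ ih =>
    have hid := maps_rep_id_id G hU
    have sum_identity (z : PairString) (hz : z.length = Layer.outputs L) :
        ∑ w ∈ ofLength (Layer.outputs (rep m (auxLayer G [.id, .id]) : Layer (extGates G))),
          Layer.kernel (L.map (oldGate G) ++ rep m (auxLayer G [.id, .id]) : Layer (extGates G))
            (A ++ U) (z ++ w) * layersKernel (copyLayers m Ls ++ Ms) (z ++ w) y =
        Layer.kernel L A z * layersKernel (copyLayers m Ls ++ Ms) (z ++ U) y := by
      have kernel_eq (w : PairString) := Layer.kernel_append (L.map (oldGate G))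
        (rep m (auxLayer G [.id, .id]) : Layer (extGates G)) (x := A) (x' := U) (y := z) (y' := w)
        (by rw [inputs_map_oldGate, hA, ha]) (by rw [outputs_map_oldGate, hz])
      rw [Finset.sum_eq_single_of_mem U (mem_ofLength.2 hid.length_right), kernel_eq,
        hid.kernel_eq U hid.length_right, if_pos rfl, mul_one,
        kernel_map_oldGate G L (hA.trans ha.symm) hz]
      intro w hw hne
      rw [kernel_eq, hid.kernel_eq w (mem_ofLength.1 hw), if_neg hne, mul_zero, zero_mul]
    change ∑ z ∈ ofLength (Layer.outputs (L.map (oldGate G) ++ rep m (auxLayer G [.id, .id]) :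
      Layer (extGates G))), _ * layersKernel (copyLayers m Ls ++ Ms) z y = _
    rw [Layer.outputs_append, sum_ofLength_add, outputs_map_oldGate]
    simp only [layersKernel, Finset.sum_mul]
    rw [Finset.sum_comm (s := ofLength c)]
    refine Finset.sum_congr rfl fun z hz => ?_
    rw [mem_ofLength] at hz
    rw [sum_identity z hz, ih (hz.trans hb), Finset.mul_sum]
    simp only [mul_assoc]

theorem layersKernel_copyLayers_selLayers_discardLayer (h : Composable m Ls 1)
    {X A S : PairString} (hX : X.length = m) (hA : A.length = m) (hS : S.length = m) :
    layersKernel (copyLayers m Ls ++ (selLayers G 0 m ++ [discardLayer G m])) (A ++ pairs X A) S =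
      (if S = A ∧ X.IsDiag then layersKernel Ls A [(true, true)] else 0) +
        (if S = X ∧ A.IsDiag then layersKernel Ls A [(false, false)] else 0) := by
  have hXA := hX.trans hA.symm
  have zipWith_true {Y B : PairString} (h : Y.length = B.length) :
      List.zipWith (select (true, true)) Y B = B := zipWith_eq_right (fun _ _ => rfl) h
  have zipWith_false {Y B : PairString} (h : Y.length = B.length) :
      List.zipWith (select (false, false)) Y B = Y := zipWith_eq_left (fun _ _ => rfl) h
  rw [layersKernel_copyLayers h hA (length_pairs hX hA), sum_ofLength_one]
  simp only [List.singleton_append, layersKernel_selLayers_discardLayer G hX hA hS,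
    Fintype.sum_prod_type, Fintype.sum_bool, zipWith_true hXA, zipWith_true hXA.symm,
    zipWith_false hXA, zipWith_false hXA.symm, reduceCtorEq, and_true, and_false, if_false,
    mul_zero, add_zero, zero_add, mul_ite, mul_one]

theorem layersKernel_roundLayers (h : Composable m Ls 1) {X S : PairString} (hX : X.length = m)
    (hS : S.length = m) :
    layersKernel (roundLayers m Ls) X S = (1 / 2) ^ m *
      ((if X.IsDiag then layersKernel Ls S [(true, true)] else 0) +
        (if S = X then ∑ A ∈ ofLength m,
          (if A.IsDiag then layersKernel Ls A [(false, false)] else 0) else 0)) := by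
  rw [roundLayers, List.cons_append, (maps_prepLayer G hX).layersKernel_cons, List.cons_append,
    List.nil_append, layersKernel, outputs_bellLayer, sum_kernel_bellLayer_mul G hX]
  have after_draw (A : PairString) (hA : A ∈ ofLength m) :
      layersKernel (rotLayers G 0 m ++ (copyLayers m Ls ++ (selLayers G 0 m ++ [discardLayer G m])))
        (triples X A A) S =
      (if S = A then if X.IsDiag then layersKernel Ls A [(true, true)] else 0 else 0) +
        (if S = X then if A.IsDiag then layersKernel Ls A [(false, false)] else 0 else 0) := by
    rw [mem_ofLength] at hA
    have hrot := layersKernel_rotLayers G (k := 0) (P := []) (S := []) rfl hX hA hA rfl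
      (copyLayers m Ls ++ (selLayers G 0 m ++ [discardLayer G m])) S
    rw [List.nil_append, List.append_nil, List.nil_append, List.append_nil] at hrot
    rw [hrot, layersKernel_copyLayers_selLayers_discardLayer h hX hA hS, ite_and, ite_and]
  rw [Finset.sum_congr rfl after_draw, Finset.sum_add_distrib, Finset.sum_ite_eq,
    if_pos (mem_ofLength.2 hS), Finset.sum_ite_irrel, Finset.sum_const_zero]

end round

/-! ### The output distribution of the sampling circuit -/

section probability

variable {G : GateSet} {m : ℕ}

theorem sum_isDiag_layersKernel_false (C : Circuit G m 1) :
    ∑ A ∈ ofLength m, (if A.IsDiag then layersKernel C.layers A [(false, false)] else 0) =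
      ((2 ^ m * (1 - avgAcceptProb C) : ℝ) : ℂ) := by
  rw [sum_isDiag, ← List.replicate_one, ← diag_const]
  simp only [C.layersKernel_diag, prob_false_eq_one_sub_acceptProb]
  rw [← Complex.ofReal_sum, Finset.sum_sub_distrib, sum_acceptProb, Finset.sum_const,
    Finset.card_univ, Fintype.card_pi_const, Fintype.card_bool, nsmul_one, mul_sub, mul_one,
    Nat.cast_pow, Nat.cast_ofNat]

theorem sum_mul_layersKernel_roundLayers (C : Circuit G m 1) (f : PairString → ℂ) (s : Bits m) :
    ∑ z ∈ ofLength m, f z * layersKernel (roundLayers m C.layers) z (diag s) =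
      ((2 : ℂ) ^ m)⁻¹ * acceptProb C s * ∑ x : Bits m, f (diag x) +
        (1 - avgAcceptProb C) * f (diag s) := by
  have kernel_eq (z : PairString) (hz : z ∈ ofLength m) :
      f z * layersKernel (roundLayers m C.layers) z (diag s) = (1 / 2) ^ m *
        (acceptProb C s * (if z.IsDiag then f z else 0) +
          (if diag s = z then f z * ((2 ^ m * (1 - avgAcceptProb C) : ℝ) : ℂ) else 0)) := by
    rw [layersKernel_roundLayers C.composable (mem_ofLength.1 hz) (length_diag s),
      sum_isDiag_layersKernel_false, ← List.replicate_one, ← diag_const, C.layersKernel_diag,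
      ← acceptProb]
    split_ifs <;> ring
  rw [Finset.sum_congr rfl kernel_eq, ← Finset.mul_sum, Finset.sum_add_distrib, ← Finset.mul_sum,
    sum_isDiag, Finset.sum_ite_eq, if_pos (mem_ofLength.2 (length_diag s))]
  push_cast
  rw [one_div, inv_pow]
  field_simp

/-- The probability that the sampling circuit for `C` holds the string `s` after `t` rounds. -/
def roundProb (C : Circuit G m 1) : ℕ → Bits m → ℝ
  | 0, s => if (fun _ => false) = s then 1 else 0
  | t + 1, s => ((2 : ℝ) ^ m)⁻¹ * acceptProb C s + (1 - avgAcceptProb C) * roundProb C t s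

theorem sum_roundProb (C : Circuit G m 1) (t : ℕ) : ∑ s, roundProb C t s = 1 := by
  induction t with
  | zero => exact (Finset.sum_ite_eq _ _ _).trans (if_pos (Finset.mem_univ _))
  | succ t ih =>
    simp only [roundProb, Finset.sum_add_distrib, ← Finset.mul_sum, ih, sum_acceptProb]
    field_simp
    ring

theorem le_roundProb (C : Circuit G m 1) (t : ℕ) (s : Bits m) :
    ((2 : ℝ) ^ m)⁻¹ * acceptProb C s * ∑ j ∈ Finset.range t, (1 - avgAcceptProb C) ^ j ≤
      roundProb C t s := by
  have h : 0 ≤ 1 - avgAcceptProb C := sub_nonneg.2 (avgAcceptProb_le_one C)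
  induction t with
  | zero =>
    rw [roundProb, Finset.range_zero, Finset.sum_empty, mul_zero]
    positivity
  | succ t ih =>
    calc ((2 : ℝ) ^ m)⁻¹ * acceptProb C s * ∑ j ∈ Finset.range (t + 1), (1 - avgAcceptProb C) ^ j
        = ((2 : ℝ) ^ m)⁻¹ * acceptProb C s + (1 - avgAcceptProb C) *
          (((2 : ℝ) ^ m)⁻¹ * acceptProb C s * ∑ j ∈ Finset.range t, (1 - avgAcceptProb C) ^ j) := by
          rw [Finset.sum_range_succ', pow_zero]
          simp only [pow_succ', ← Finset.mul_sum]
          ring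
      _ ≤ roundProb C (t + 1) s := add_le_add_right (mul_le_mul_of_nonneg_left ih h) _

theorem layersKernel_rep_roundLayers (C : Circuit G m 1) (t : ℕ) (s : Bits m) :
    layersKernel (rep t (roundLayers m C.layers)) (diag fun _ : Fin m => false) (diag s) =
      (roundProb C t s : ℂ) := by
  induction t generalizing s with
  | zero =>
    rw [rep_zero, layersKernel, roundProb, apply_ite Complex.ofReal, Complex.ofReal_one,
      Complex.ofReal_zero]
    exact if_congr diag_injective.eq_iff rfl rfl
  | succ t ih =>
    rw [rep_succ, ← rep_append_comm, layersKernel_append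
      ((composable_roundLayers C.composable).rep t) _ (length_diag _),
      sum_mul_layersKernel_roundLayers]
    simp only [ih]
    rw [← Complex.ofReal_sum, sum_roundProb, roundProb]
    push_cast
    ring

theorem prob_of_layers_eq_sampleLayers (C : Circuit G m 1) (D : Circuit (extGates G) 0 m)
    (hD : D.layers = sampleLayers m C.layers) (s : Bits m) :
    D.prob Fin.elim0 s = roundProb C (2 ^ m) s := by
  have h := D.layersKernel_diag Fin.elim0 s
  have diag_elim0 : diag (Fin.elim0 : Bits 0) = [] := rfl
  rw [hD, sampleLayers, diag_elim0, (maps_rep_prep G m).layersKernel_cons,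
    layersKernel_rep_roundLayers] at h
  exact_mod_cast h.symm

theorem one_le_geom_sum_mul {a : ℝ} (ha : 0 ≤ a) (ha' : a ≤ 1) {T : ℕ} (hT : 0 < T) :
    1 ≤ (∑ j ∈ Finset.range T, (1 - a) ^ j) * ((T : ℝ)⁻¹ + a) := by
  have hT' : (0 : ℝ) < T := Nat.cast_pos.2 hT
  have geom_sum_mul : (∑ j ∈ Finset.range T, (1 - a) ^ j) * a = 1 - (1 - a) ^ T := by
    have := geom_sum_mul_neg (1 - a) T
    rwa [sub_sub_cancel] at this
  have card_mul_le : (T : ℝ) * (1 - a) ^ T ≤ ∑ j ∈ Finset.range T, (1 - a) ^ j := by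
    have := Finset.card_nsmul_le_sum (Finset.range T) (fun j => (1 - a) ^ j) ((1 - a) ^ T)
      fun j hj => pow_le_pow_of_le_one (by linarith) (by linarith) (Finset.mem_range.1 hj).le
    rwa [Finset.card_range, nsmul_eq_mul] at this
  have pow_le : (1 - a) ^ T ≤ (∑ j ∈ Finset.range T, (1 - a) ^ j) * (T : ℝ)⁻¹ := by
    rw [← div_eq_mul_inv, le_div_iff₀ hT']
    linarith
  rw [mul_add, geom_sum_mul]
  linarith

theorem acceptProb_le_of_prob_lt (C : Circuit G m 1) (D : Circuit (extGates G) 0 m)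
    (hD : D.layers = sampleLayers m C.layers) (s : Bits m) {q : ℝ}
    (h : D.prob Fin.elim0 s < q * ((2 : ℝ) ^ m)⁻¹) :
    acceptProb C s ≤ q * (((2 : ℝ) ^ m)⁻¹ + avgAcceptProb C) := by
  rw [prob_of_layers_eq_sampleLayers C D hD] at h
  set S := ∑ j ∈ Finset.range (2 ^ m), (1 - avgAcceptProb C) ^ j with hS
  have one_le : 1 ≤ S * (((2 : ℝ) ^ m)⁻¹ + avgAcceptProb C) := by
    simpa only [Nat.cast_pow, Nat.cast_ofNat, ← hS] using one_le_geom_sum_mul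
      (avgAcceptProb_nonneg C) (avgAcceptProb_le_one C) (T := 2 ^ m) (Nat.two_pow_pos m)
  have inv_pos : (0 : ℝ) < ((2 : ℝ) ^ m)⁻¹ := by positivity
  have mul_le : acceptProb C s * S ≤ q := by
    refine le_of_mul_le_mul_right ?_ inv_pos
    calc acceptProb C s * S * ((2 : ℝ) ^ m)⁻¹ = ((2 : ℝ) ^ m)⁻¹ * acceptProb C s * S := by ring
      _ ≤ q * ((2 : ℝ) ^ m)⁻¹ := (le_roundProb C (2 ^ m) s).trans h.le
  calc acceptProb C s ≤ acceptProb C s * (S * (((2 : ℝ) ^ m)⁻¹ + avgAcceptProb C)) :=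
        le_mul_of_one_le_right (acceptProb_nonneg C s) one_le
    _ = acceptProb C s * S * (((2 : ℝ) ^ m)⁻¹ + avgAcceptProb C) := by ring
    _ ≤ q * (((2 : ℝ) ^ m)⁻¹ + avgAcceptProb C) :=
        mul_le_mul_of_nonneg_right mul_le (add_nonneg inv_pos.le (avgAcceptProb_nonneg C))

end probability

/-! ### The program that writes the description of the sampling circuit -/

section code

variable {G : GateSet}

/-- The description of the gates of a layer, without the final `0` of the layer. -/
def gatesCode (L : Layer G) : List Bool :=
  L.flatMap fun i => List.replicate (i.val + 1) true ++ [false]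

theorem layerCode_eq_gatesCode_append (L : Layer G) :
    Circuit.layerCode L = gatesCode L ++ [false] := rfl

theorem gatesCode_append (L L' : Layer G) :
    gatesCode (L ++ L' : Layer G) = gatesCode L ++ gatesCode L' := List.flatMap_append

theorem gatesCode_map_oldGate (L : Layer G) :
    gatesCode (L.map (oldGate G) : Layer (extGates G)) = gatesCode L :=
  List.flatMap_map _ _ _

theorem flatMap_rep {α β : Type*} (f : α → List β) (m : ℕ) (w : List α) :
    (rep m w).flatMap f = rep m (w.flatMap f) := by
  induction m with
  | zero => rfl
  | succ m ih => rw [rep_succ, rep_succ, List.flatMap_append, ih]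

theorem gatesCode_rep (m : ℕ) (L : Layer G) :
    gatesCode (rep m L : Layer G) = rep m (gatesCode L) := flatMap_rep _ m L

theorem flatMap_const_eq_rep {α β : Type*} (l : List α) (w : List β) :
    (l.flatMap fun _ => w) = rep l.length w := by
  rw [rep, ← List.map_const', List.flatMap_def]

theorem length_rep {α : Type*} (m : ℕ) (w : List α) : (rep m w).length = m * w.length := by
  rw [rep, List.length_flatten, List.map_replicate, List.sum_replicate, smul_eq_mul]

end code

/-- The stacks of the program that writes the sampling circuit: `i` holds the description of the
given circuit and finally the output, `u` and `q` are unary counters, `s` is the text written so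
far, and `t` and `x` are auxiliary. -/
inductive Stk : Type
  | i | u | q | t | s | x
  deriving DecidableEq

open Prog

namespace Stk

instance : Fintype Stk := ⟨{.i, .u, .q, .t, .s, .x}, fun k => by cases k <;> decide⟩

/-- The stacks with given contents. The stacks `s` and `x` are given bottom first, so that emitting
a word on `s` appends it. -/
def cfg (i : List Bool) (u q : ℕ) (t s x : List Bool) : Stk → List Bool
  | .i => i
  | .u => List.replicate u true
  | .q => List.replicate q true
  | .t => t
  | .s => s.reverse
  | .x => x.reverse

theorem nil_eq_cfg : (fun _ : Stk => ([] : List Bool)) = cfg [] 0 0 [] [] [] := by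
  funext k; cases k <;> rfl

variable {i : List Bool} {u q : ℕ} {t s x : List Bool} (w : List Bool) (n : ℕ)

@[simp] theorem cfg_i : cfg i u q t s x .i = i := rfl
@[simp] theorem cfg_u : cfg i u q t s x .u = List.replicate u true := rfl
@[simp] theorem cfg_q : cfg i u q t s x .q = List.replicate q true := rfl
@[simp] theorem cfg_t : cfg i u q t s x .t = t := rfl
@[simp] theorem cfg_s : cfg i u q t s x .s = s.reverse := rfl
@[simp] theorem cfg_x : cfg i u q t s x .x = x.reverse := rfl

@[simp] theorem update_cfg_i : update (cfg i u q t s x) .i w = cfg w u q t s x := by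
  funext k; cases k <;> rfl

@[simp] theorem update_cfg_u :
    update (cfg i u q t s x) .u (List.replicate n true) = cfg i n q t s x := by
  funext k; cases k <;> rfl

@[simp] theorem update_cfg_q :
    update (cfg i u q t s x) .q (List.replicate n true) = cfg i u n t s x := by
  funext k; cases k <;> rfl

@[simp] theorem update_cfg_u_nil : update (cfg i u q t s x) .u [] = cfg i 0 q t s x :=
  update_cfg_u 0

@[simp] theorem update_cfg_q_nil : update (cfg i u q t s x) .q [] = cfg i u 0 t s x :=
  update_cfg_q 0

@[simp] theorem update_cfg_t : update (cfg i u q t s x) .t w = cfg i u q w s x := by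
  funext k; cases k <;> rfl

@[simp] theorem update_cfg_s : update (cfg i u q t s x) .s w = cfg i u q t w.reverse x := by
  funext k; cases k <;> simp [cfg]

@[simp] theorem update_cfg_x : update (cfg i u q t s x) .x w = cfg i u q t s w.reverse := by
  funext k; cases k <;> simp [cfg]

theorem exec_emit_i : (emit .i w).Exec (cfg i u q t s x) (cfg (w.reverse ++ i) u q t s x) 1 :=
  .emit (update_cfg_i _)

theorem exec_emit_u : (emit .u [true]).Exec (cfg i u q t s x) (cfg i (u + 1) q t s x) 1 :=
  .emit (update_cfg_u (u + 1))

theorem exec_emit_q : (emit .q [true]).Exec (cfg i u q t s x) (cfg i u (q + 1) t s x) 1 :=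
  .emit (update_cfg_q (q + 1))

theorem exec_emit_s : (emit .s w).Exec (cfg i u q t s x) (cfg i u q t (s ++ w) x) 1 :=
  .emit (by simp)

end Stk

open Stk

section move

variable {K : Type} [DecidableEq K]

/-- Move a stack onto another one, reversing it. -/
def moveProg (k k' : K) : Prog K := loop k fun b => emit k' [b]

theorem exec_moveProg {k k' : K} (h : k ≠ k') (T : K → List Bool) :
    (moveProg k k').Exec T (update (update T k []) k' ((T k).reverse ++ T k'))
      (2 * (T k).length + 1) := by
  generalize hl : T k = l
  induction l generalizing T with
  | nil =>
    have final : update (update T k []) k' ([].reverse ++ T k') = T := by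
      rw [← hl, update_eq_self]
      exact update_eq_self_iff.2 (by rw [hl]; rfl)
    rw [final]
    exact .loop_nil hl
  | cons b l ih =>
    set T₁ := update (update T k l) k' (b :: T k') with hT₁
    have final : update (update T k []) k' ((b :: l).reverse ++ T k') =
        update (update T₁ k []) k' (l.reverse ++ T₁ k') := by
      funext j
      by_cases hj : j = k' <;> by_cases hj' : j = k <;> simp_all
    have next : (emit k' [b]).Exec (update T k l) T₁ 1 := .emit (by simp [hT₁, h.symm])
    rw [final]
    exact (Exec.loop_cons hl rfl next (ih T₁ (by simp [hT₁, h]))).mono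
      (by rw [List.length_cons]; omega)

/-- Move the stack `k` onto `k'`, and for each letter `b` write the word `f b` on `k''`. -/
def mapProg (k k' k'' : K) (f : Bool → List Bool) : Prog K :=
  loop k fun b => seq (emit k' [b]) (emit k'' (f b))

theorem exec_mapProg {k k' k'' : K} (h : k ≠ k') (h' : k ≠ k'') (h'' : k' ≠ k'')
    (f : Bool → List Bool) (T : K → List Bool) :
    (mapProg k k' k'' f).Exec T
      (update (update (update T k []) k' ((T k).reverse ++ T k')) k''
        (((T k).flatMap f).reverse ++ T k'')) (3 * (T k).length + 1) := by
  generalize hl : T k = l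
  induction l generalizing T with
  | nil =>
    have final : update (update (update T k []) k' ([].reverse ++ T k')) k''
        ((List.flatMap f []).reverse ++ T k'') = T := by
      funext j
      by_cases hj : j = k'' <;> by_cases hj' : j = k' <;> by_cases hj'' : j = k <;>
        simp_all [update_apply]
    rw [final]
    exact .loop_nil hl
  | cons b l ih =>
    set T₁ := update (update (update T k l) k' (b :: T k')) k'' ((f b).reverse ++ T k'') with hT₁
    have final : update (update (update T k []) k' ((b :: l).reverse ++ T k')) k''
        (((b :: l).flatMap f).reverse ++ T k'') =
        update (update (update T₁ k []) k' (l.reverse ++ T₁ k')) k''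
          ((l.flatMap f).reverse ++ T₁ k'') := by
      funext j
      by_cases hj : j = k'' <;> by_cases hj' : j = k' <;> by_cases hj'' : j = k <;>
        simp_all
    have next : (seq (emit k' [b]) (emit k'' (f b))).Exec (update T k l) T₁ (1 + 1) :=
      .seq (.emit rfl) (.emit (by simp [hT₁, h.symm, h'.symm, h''.symm]))
    rw [final]
    exact (Exec.loop_cons hl rfl next (ih T₁ (by simp [hT₁, h, h']))).mono
      (by rw [List.length_cons]; omega)

end move

section programs

variable {i : List Bool} {u q : ℕ} {t s x : List Bool}

/-- Write the word `w` once for every letter on the stack `k`. -/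
def emitRep (k : Stk) (w : List Bool) : Prog Stk :=
  seq (mapProg k .t .s fun _ => w) (moveProg .t k)

theorem exec_emitRep_u (w : List Bool) :
    (emitRep .u w).Exec (cfg i u q [] s x) (cfg i u q [] (s ++ rep u w) x) (5 * u + 2) := by
  have forth : (mapProg .u .t .s fun _ => w).Exec (cfg i u q [] s x)
      (cfg i 0 q (List.replicate u true) (s ++ rep u w) x) (3 * u + 1) := by
    simpa [flatMap_const_eq_rep] using exec_mapProg (k := Stk.u) (k' := .t) (k'' := .s)
      (by decide) (by decide) (by decide) (fun _ => w) (cfg i u q [] s x)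
  have back : (moveProg .t .u).Exec (cfg i 0 q (List.replicate u true) (s ++ rep u w) x)
      (cfg i u q [] (s ++ rep u w) x) (2 * u + 1) := by
    simpa using exec_moveProg (k := Stk.t) (k' := .u) (by decide)
      (cfg i 0 q (List.replicate u true) (s ++ rep u w) x)
  exact (forth.seq back).mono (by omega)

theorem exec_emitRep_q (w : List Bool) :
    (emitRep .q w).Exec (cfg i u q [] s x) (cfg i u q [] (s ++ rep q w) x) (5 * q + 2) := by
  have forth : (mapProg .q .t .s fun _ => w).Exec (cfg i u q [] s x)
      (cfg i u 0 (List.replicate q true) (s ++ rep q w) x) (3 * q + 1) := by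
    simpa [flatMap_const_eq_rep] using exec_mapProg (k := Stk.q) (k' := .t) (k'' := .s)
      (by decide) (by decide) (by decide) (fun _ => w) (cfg i u q [] s x)
  have back : (moveProg .t .q).Exec (cfg i u 0 (List.replicate q true) (s ++ rep q w) x)
      (cfg i u q [] (s ++ rep q w) x) (2 * q + 1) := by
    simpa using exec_moveProg (k := Stk.t) (k' := .q) (by decide)
      (cfg i u 0 (List.replicate q true) (s ++ rep q w) x)
  exact (forth.seq back).mono (by omega)

/-- Read a unary number from the stack `i` into the counter `u`. -/
def readProg : Prog Stk := whileTrue .i (emit .u [true])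

theorem exec_readProg (m : ℕ) :
    readProg.Exec (cfg (List.replicate m true ++ false :: i) u q t s x)
      (cfg i (u + m) q t s x) (2 * m + 1) := by
  induction m generalizing u with
  | zero => exact .while_false rfl (update_cfg_i _)
  | succ m ih =>
    have rest := ih (u := u + 1)
    rw [add_right_comm] at rest
    exact .mono (.while_true (l := List.replicate m true ++ false :: i) rfl (update_cfg_i _)
      exec_emit_u rest) (by omega)

/-- Copy the description of a gate from the stack `i`, without its first letter. -/
def copyGateProg : Prog Stk := seq (whileTrue .i (emit .s [true])) (emit .s [false])

theorem exec_copyGateProg (a : ℕ) :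
    copyGateProg.Exec (cfg (List.replicate a true ++ false :: i) u q t s x)
      (cfg i u q t (s ++ (List.replicate a true ++ [false])) x) (2 * a + 2) := by
  rw [← List.append_assoc]
  refine .seq (t₁ := 2 * a + 1) ?_ (exec_emit_s [false])
  induction a generalizing s with
  | zero =>
    rw [List.replicate_zero, List.append_nil]
    exact .while_false rfl (update_cfg_i _)
  | succ a ih =>
    have rest := ih (s := s ++ [true])
    rw [List.append_assoc, List.singleton_append, ← List.replicate_succ] at rest
    exact .mono (.while_true (l := List.replicate a true ++ false :: i) rfl (update_cfg_i _)
      (exec_emit_s _) rest) (by omega)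

/-- Double the text written so far. -/
def doubleProg : Prog Stk :=
  seq (moveProg .s .t) (seq (mapProg .t .s .x fun b => [b]) (seq (moveProg .x .t) (moveProg .t .s)))

theorem exec_doubleProg :
    doubleProg.Exec (cfg i u q [] s []) (cfg i u q [] (s ++ s) []) (9 * s.length + 4) := by
  have lift : (moveProg .s .t).Exec (cfg i u q [] s []) (cfg i u q s [] [])
      (2 * s.length + 1) := by
    simpa using exec_moveProg (k := Stk.s) (k' := .t) (by decide) (cfg i u q [] s [])
  have copy : (mapProg .t .s .x fun b => [b]).Exec (cfg i u q s [] []) (cfg i u q [] s s)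
      (3 * s.length + 1) := by
    simpa using exec_mapProg (k := Stk.t) (k' := .s) (k'' := .x) (by decide) (by decide)
      (by decide) (fun b => [b]) (cfg i u q s [] [])
  have lift' : (moveProg .x .t).Exec (cfg i u q [] s s) (cfg i u q s s [])
      (2 * s.length + 1) := by
    simpa using exec_moveProg (k := Stk.x) (k' := .t) (by decide) (cfg i u q [] s s)
  have lower : (moveProg .t .s).Exec (cfg i u q s s []) (cfg i u q [] (s ++ s) [])
      (2 * s.length + 1) := by
    simpa using exec_moveProg (k := Stk.t) (k' := .s) (by decide) (cfg i u q s s [])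
  exact (lift.seq (copy.seq (lift'.seq lower))).mono (by omega)

/-- Double the text as often as the counter `u` says, and move this counter to `q`. -/
def powerProg : Prog Stk := whileTrue .u (seq doubleProg (emit .q [true]))

theorem exec_powerProg (m : ℕ) :
    powerProg.Exec (cfg i m q [] s []) (cfg i 0 (q + m) [] (rep (2 ^ m) s) [])
      (m * (9 * (2 ^ m * s.length) + 6) + 1) := by
  induction m generalizing q s with
  | zero =>
    have rep_one : rep (2 ^ 0) s = s := List.append_nil s
    rw [rep_one]
    exact .mono (.while_nil rfl) (by omega)
  | succ m ih =>
    have rest := ih (q := q + 1) (s := s ++ s)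
    rw [rep_append_self, ← pow_succ', List.length_append, ← two_mul, ← mul_assoc (2 ^ m),
      ← pow_succ, add_right_comm] at rest
    have length_le : s.length ≤ 2 ^ (m + 1) * s.length := Nat.le_mul_of_pos_left _ (by positivity)
    exact .mono (.while_true rfl (update_cfg_u m) (exec_doubleProg.seq exec_emit_q) rest)
      (by rw [add_mul]; omega)

variable {G : GateSet}

variable (G) in
/-- The description of additional gates in a layer. -/
def auxCode (w : List AuxGate) : List Bool := gatesCode (auxLayer G w)

variable (G) in
/-- Write the first two layers of a round. -/
def pairsProg : Prog Stk :=
  seq (emitRep .u (auxCode G [.id, .prep, .prep])) (seq (emit .s [false])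
    (seq (emitRep .u (auxCode G [.id, .bell])) (emit .s [false])))

theorem exec_pairsProg :
    (pairsProg G).Exec (cfg i u q [] s x)
      (cfg i u q [] (s ++ [prepLayer G u, bellLayer G u].flatMap Circuit.layerCode) x)
      (10 * u + 6) := by
  have text : s ++ [prepLayer G u, bellLayer G u].flatMap Circuit.layerCode =
      s ++ rep u (auxCode G [.id, .prep, .prep]) ++ [false] ++ rep u (auxCode G [.id, .bell]) ++
        [false] := by
    simp [layerCode_eq_gatesCode_append, prepLayer, bellLayer, gatesCode_rep, auxCode]
  rw [text]
  exact .mono ((exec_emitRep_u _).seq ((exec_emit_s _).seq ((exec_emitRep_u _).seq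
    (exec_emit_s _)))) (by omega)

variable (G) in
/-- Write the layers that move the last qubit of each triple to the front. -/
def rotProg : Prog Stk :=
  whileTrue .u (seq (emitRep .q (auxCode G [.id])) (seq (emit .s (auxCode G [.rot]))
    (seq (emitRep .u (auxCode G [.rot])) (seq (emitRep .q (auxCode G [.id, .id]))
      (seq (emit .s [false]) (emit .q [true]))))))

theorem exec_rotProg {M j k : ℕ} (hM : j + k ≤ M) :
    (rotProg G).Exec (cfg i j k [] s x)
      (cfg i 0 (k + j) [] (s ++ (rotLayers G k j).flatMap Circuit.layerCode) x)
      (j * (15 * M + 10) + 1) := by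
  induction j generalizing k s with
  | zero =>
    rw [rotLayers, List.flatMap_nil, List.append_nil]
    exact .mono (.while_nil rfl) (by omega)
  | succ j ih =>
    have text : s ++ (rotLayers G k (j + 1)).flatMap Circuit.layerCode =
        s ++ rep k (auxCode G [.id]) ++ auxCode G [.rot] ++ rep j (auxCode G [.rot]) ++
          rep k (auxCode G [.id, .id]) ++ [false] ++
          (rotLayers G (k + 1) j).flatMap Circuit.layerCode := by
      simp [layerCode_eq_gatesCode_append, rotLayers, rotLayer, gatesCode_append, gatesCode_rep,
        rep_succ, auxCode]
    rw [text, ← add_assoc, add_right_comm]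
    exact .mono (.while_true rfl (update_cfg_u j) ((exec_emitRep_q _).seq ((exec_emit_s _).seq
      ((exec_emitRep_u _).seq ((exec_emitRep_q _).seq ((exec_emit_s _).seq exec_emit_q)))))
      (ih (by omega))) (by rw [add_mul]; omega)

variable (G) in
/-- Copy the layers of the given circuit, extending each by the identity on further qubits. -/
def copyProg : Prog Stk :=
  loop .i fun b => if b then seq (emit .s [true]) copyGateProg
    else seq (emitRep .q (auxCode G [.id, .id])) (emit .s [false])

theorem exec_copyProg_layer (L : Layer G) {T : Stk → List Bool} {t : ℕ}
    (h : (copyProg G).Exec (cfg i u q []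
      (s ++ gatesCode L ++ rep q (auxCode G [.id, .id]) ++ [false]) x) T t) :
    (copyProg G).Exec (cfg (Circuit.layerCode L ++ i) u q [] s x) T
      ((Circuit.layerCode L).length * (5 * q + 4) + t) := by
  induction L generalizing s with
  | nil =>
    rw [gatesCode, List.flatMap_nil, List.append_nil] at h
    exact .mono (.loop_cons rfl (update_cfg_i _) ((exec_emitRep_q _).seq (exec_emit_s _)) h)
      (by simp [Circuit.layerCode]; omega)
  | cons a L ih =>
    have code : Circuit.layerCode (a :: L) ++ i =
        true :: (List.replicate a true ++ false :: (Circuit.layerCode L ++ i)) := by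
      simp [Circuit.layerCode, List.replicate_succ]
    have length_code : (Circuit.layerCode (a :: L)).length =
        (a + 2) + (Circuit.layerCode L).length := by
      simp [Circuit.layerCode]; omega
    have text : gatesCode (a :: L) =
        [true] ++ (List.replicate a true ++ [false]) ++ gatesCode L := by
      simp [gatesCode, List.replicate_succ]
    have gate_le : (a + 2) * 4 ≤ (a + 2) * (5 * q + 4) := Nat.mul_le_mul_left _ (by omega)
    rw [text, ← List.append_assoc s, ← List.append_assoc s] at h
    rw [code]
    exact .mono (.loop_cons rfl (update_cfg_i _) ((exec_emit_s _).seq (exec_copyGateProg _)) (ih h))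
      (by rw [length_code, add_mul]; omega)

theorem exec_copyProg (Ls : List (Layer G)) :
    (copyProg G).Exec (cfg (Ls.flatMap Circuit.layerCode) u q [] s x)
      (cfg [] u q [] (s ++ (copyLayers q Ls).flatMap Circuit.layerCode) x)
      ((Ls.flatMap Circuit.layerCode).length * (5 * q + 4) + 1) := by
  induction Ls generalizing s with
  | nil =>
    rw [copyLayers, List.map_nil, List.flatMap_nil, List.flatMap_nil, List.append_nil]
    exact .mono (.loop_nil rfl) (by omega)
  | cons L Ls ih =>
    have text : s ++ (copyLayers q (L :: Ls)).flatMap Circuit.layerCode =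
        s ++ gatesCode L ++ rep q (auxCode G [.id, .id]) ++ [false] ++
          (copyLayers q Ls).flatMap Circuit.layerCode := by
      simp [layerCode_eq_gatesCode_append, copyLayers, gatesCode_append, gatesCode_rep,
        gatesCode_map_oldGate, auxCode]
    rw [text, List.flatMap_cons, List.length_append, add_mul, add_assoc]
    exact exec_copyProg_layer L ih

variable (G) in
/-- Write the layers that swap the members of each pair if the control qubit is set. -/
def selProg : Prog Stk :=
  whileTrue .q (seq (emitRep .u (auxCode G [.id, .id])) (seq (emit .s (auxCode G [.sel]))
    (seq (emitRep .q (auxCode G [.id, .id])) (seq (emit .s [false]) (emit .u [true])))))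

theorem exec_selProg {M j k : ℕ} (hM : j + k ≤ M) :
    (selProg G).Exec (cfg i k j [] s x)
      (cfg i (k + j) 0 [] (s ++ (selLayers G k j).flatMap Circuit.layerCode) x)
      (j * (10 * M + 8) + 1) := by
  induction j generalizing k s with
  | zero =>
    rw [selLayers, List.flatMap_nil, List.append_nil]
    exact .mono (.while_nil rfl) (by omega)
  | succ j ih =>
    have text : s ++ (selLayers G k (j + 1)).flatMap Circuit.layerCode =
        s ++ rep k (auxCode G [.id, .id]) ++ auxCode G [.sel] ++ rep j (auxCode G [.id, .id]) ++
          [false] ++ (selLayers G (k + 1) j).flatMap Circuit.layerCode := by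
      simp [layerCode_eq_gatesCode_append, selLayers, selLayer, gatesCode_append, gatesCode_rep,
        auxCode]
    rw [text, ← add_assoc, add_right_comm]
    exact .mono (.while_true rfl (update_cfg_q j) ((exec_emitRep_u _).seq ((exec_emit_s _).seq
      ((exec_emitRep_q _).seq ((exec_emit_s _).seq exec_emit_u)))) (ih (by omega)))
      (by rw [add_mul]; omega)

variable (G) in
/-- Write the last layer of a round. -/
def discardProg : Prog Stk :=
  seq (emitRep .u (auxCode G [.id, .trace])) (emit .s (auxCode G [.trace] ++ [false]))

theorem exec_discardProg :
    (discardProg G).Exec (cfg i u q [] s x)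
      (cfg i u q [] (s ++ Circuit.layerCode (discardLayer G u)) x) (5 * u + 3) := by
  have text : s ++ Circuit.layerCode (discardLayer G u) =
      s ++ rep u (auxCode G [.id, .trace]) ++ (auxCode G [.trace] ++ [false]) := by
    simp [layerCode_eq_gatesCode_append, discardLayer, gatesCode_append, gatesCode_rep, auxCode]
  rw [text]
  exact (exec_emitRep_u _).seq (exec_emit_s _)

/-- Move the description of a circuit to the stack `i` and read its number of input qubits. -/
def loadProg : Prog Stk := seq (moveProg .t .i) readProg

theorem exec_loadProg {m b : ℕ} (C : Circuit G m b) :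
    loadProg.Exec (cfg [] 0 0 C.code.reverse [] [])
      (cfg (C.layers.flatMap Circuit.layerCode) m 0 [] [] [])
      (2 * C.code.length + 2 * m + 2) := by
  have move : (moveProg .t .i).Exec (cfg [] 0 0 C.code.reverse [] []) (cfg C.code 0 0 [] [] [])
      (2 * C.code.length + 1) := by
    simpa using exec_moveProg (k := Stk.t) (k' := .i) (by decide) (cfg [] 0 0 C.code.reverse [] [])
  have read := exec_readProg (i := C.layers.flatMap Circuit.layerCode) (u := 0) (q := 0) (t := [])
    (s := []) (x := []) m
  rw [zero_add, List.append_cons] at read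
  exact .mono (move.seq read) (by omega)

variable (G) in
/-- Write the layers of one round. -/
def roundProg : Prog Stk :=
  seq loadProg (seq (pairsProg G) (seq (rotProg G) (seq (copyProg G) (seq (selProg G)
    (discardProg G)))))

/-- A bound for the number of steps of `roundProg` on a description of length `n`. -/
def roundTime (n : ℕ) : ℕ := 45 * (n + 1) ^ 2

theorem exec_roundProg {m b : ℕ} (C : Circuit G m b) :
    (roundProg G).Exec (cfg [] 0 0 C.code.reverse [] [])
      (cfg [] m 0 [] ((roundLayers m C.layers).flatMap Circuit.layerCode) [])
      (roundTime C.code.length) := by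
  have rot (i s) := exec_rotProg (G := G) (i := i) (s := s) (x := []) (j := m) (k := 0) le_rfl
  have sel (i s) := exec_selProg (G := G) (i := i) (s := s) (x := []) (j := m) (k := 0) le_rfl
  simp only [zero_add, add_zero] at rot sel
  have text : (roundLayers m C.layers).flatMap Circuit.layerCode = [] ++
      [prepLayer G m, bellLayer G m].flatMap Circuit.layerCode ++
      (rotLayers G 0 m).flatMap Circuit.layerCode ++
      (copyLayers m C.layers).flatMap Circuit.layerCode ++
      (selLayers G 0 m).flatMap Circuit.layerCode ++ Circuit.layerCode (discardLayer G m) := by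
    simp [roundLayers]
  rw [text]
  refine .mono ((exec_loadProg C).seq (exec_pairsProg.seq ((rot _ _).seq
    ((exec_copyProg C.layers).seq ((sel _ _).seq exec_discardProg))))) ?_
  have length_code : C.code.length = m + 1 + (C.layers.flatMap Circuit.layerCode).length := by
    rw [Circuit.code, List.length_append, List.length_append, List.length_replicate,
      List.length_singleton]
  generalize (C.layers.flatMap Circuit.layerCode).length = l at length_code ⊢
  rw [roundTime, length_code]
  nlinarith [Nat.zero_le (m * l)]

variable (G) in
/-- Move the text to the stack `i` and write in front of it the rest of the description. -/
def finishProg : Prog Stk :=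
  seq (moveProg .s .i) (seq (emit .i [false]) (seq
    (whileTrue .q (emit .i (auxCode G [.prep]).reverse)) (emit .i [false])))

theorem exec_finishProg :
    (finishProg G).Exec (cfg i u q t s x)
      (cfg (false :: (rep q (auxCode G [.prep]) ++ false :: (s ++ i))) u 0 t [] x)
      (2 * s.length + 2 * q + 4) := by
  have preps (i : List Bool) : (whileTrue .q (emit .i (auxCode G [.prep]).reverse)).Exec
      (cfg i u q t [] x) (cfg (rep q (auxCode G [.prep]) ++ i) u 0 t [] x) (2 * q + 1) := by
    induction q generalizing i with
    | zero => exact .while_nil rfl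
    | succ q ih =>
      have next := exec_emit_i (i := i) (u := u) (q := q) (t := t) (s := []) (x := x)
        (auxCode G [.prep]).reverse
      have rest := ih (auxCode G [.prep] ++ i)
      rw [List.reverse_reverse] at next
      rw [← List.append_assoc, rep_append_comm, ← rep_succ] at rest
      exact .mono (.while_true rfl (update_cfg_q q) next rest) (by omega)
  have move : (moveProg .s .i).Exec (cfg i u q t s x) (cfg (s ++ i) u q t [] x)
      (2 * s.length + 1) := by
    simpa using exec_moveProg (k := Stk.s) (k' := .i) (by decide) (cfg i u q t s x)
  exact .mono (move.seq ((exec_emit_i _).seq ((preps _).seq (exec_emit_i _)))) (by omega)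

variable (G) in
/-- From the description of a circuit over `G`, compute the description of the circuit that samples
a string on which the given circuit accepts. -/
def sampleProg : Prog Stk := seq (roundProg G) (seq powerProg (finishProg G))

variable (G) in
/-- A bound for the number of steps of `sampleProg` on a description of length `n` of a circuit with
`m` input qubits. -/
def sampleTime (n m : ℕ) : ℕ :=
  roundTime n + (m * (9 * (2 ^ m * ((roundProg G).width * roundTime n)) + 6) + 1 +
    (2 * (2 ^ m * ((roundProg G).width * roundTime n)) + 2 * m + 4))

theorem exec_sampleProg {m b c : ℕ} (C : Circuit G m b) (D : Circuit (extGates G) 0 c)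
    (hD : D.layers = sampleLayers m C.layers) :
    (sampleProg G).Exec (update (fun _ => []) .t C.code.reverse) (update (fun _ => []) .i D.code)
      (sampleTime G C.code.length m) := by
  rw [nil_eq_cfg, update_cfg_t, update_cfg_i]
  set w := (roundLayers m C.layers).flatMap Circuit.layerCode with hw
  have code : D.code = false :: (rep m (auxCode G [.prep]) ++ false :: (rep (2 ^ m) w ++ [])) := by
    simp [Circuit.code, hD, sampleLayers, layerCode_eq_gatesCode_append, gatesCode_rep, auxCode,
      flatMap_rep, hw]
  have round := exec_roundProg C
  have length_le : w.length ≤ (roundProg G).width * roundTime C.code.length := by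
    simpa [hw] using round.length_le .s le_rfl
  have power := exec_powerProg (i := []) (q := 0) (s := w) m
  rw [zero_add] at power
  rw [code]
  refine .mono (round.seq (power.seq exec_finishProg)) ?_
  have power_le : m * (9 * (2 ^ m * w.length) + 6) ≤
      m * (9 * (2 ^ m * ((roundProg G).width * roundTime C.code.length)) + 6) := by gcongr
  have finish_le : 2 * (2 ^ m * w.length) ≤
      2 * (2 ^ m * ((roundProg G).width * roundTime C.code.length)) := by gcongr
  rw [sampleTime, length_rep]
  omega

end programs

open Filter

/-! ### The families of sampling circuits -/

/-- Functions bounded by `2 ^ p(n)` for a polynomial `p`. -/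
def ExpBounded (f : ℕ → ℕ) : Prop := ∃ p : Polynomial ℕ, ∀ n, f n ≤ 2 ^ p.eval n

namespace ExpBounded

variable {f g : ℕ → ℕ}

theorem mono (hg : ExpBounded g) (h : ∀ n, f n ≤ g n) : ExpBounded f :=
  hg.imp fun _ hp n => (h n).trans (hp n)

theorem const (c : ℕ) : ExpBounded fun _ => c :=
  ⟨Polynomial.C c, fun n => by simpa using Nat.lt_two_pow_self.le⟩

theorem natCast : ExpBounded fun n => n :=
  ⟨Polynomial.X, fun n => by simpa using Nat.lt_two_pow_self.le⟩

theorem mul (hf : ExpBounded f) (hg : ExpBounded g) : ExpBounded fun n => f n * g n := by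
  obtain ⟨p, hp⟩ := hf
  obtain ⟨q, hq⟩ := hg
  exact ⟨p + q, fun n => by rw [Polynomial.eval_add, pow_add]; exact Nat.mul_le_mul (hp n) (hq n)⟩

theorem add (hf : ExpBounded f) (hg : ExpBounded g) : ExpBounded fun n => f n + g n := by
  obtain ⟨p, hp⟩ := hf
  obtain ⟨q, hq⟩ := hg
  refine ⟨p + q + 1, fun n => ?_⟩
  rw [Polynomial.eval_add, Polynomial.eval_add, Polynomial.eval_one, pow_succ, mul_two]
  exact add_le_add ((hp n).trans (Nat.pow_le_pow_right two_pos (Nat.le_add_right _ _)))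
    ((hq n).trans (Nat.pow_le_pow_right two_pos (Nat.le_add_left _ _)))

theorem two_pow_of_isBigO {k : ℕ}
    (h : (fun n : ℕ => (f n : ℝ)) =O[atTop] fun n : ℕ => (n : ℝ) ^ k) :
    ExpBounded fun n => 2 ^ f n := by
  obtain ⟨c, hc⟩ := h.bound
  obtain ⟨N, hN⟩ := eventually_atTop.1 hc
  refine ⟨Polynomial.C ⌈c⌉₊ * Polynomial.X ^ k + Polynomial.C (∑ i ∈ Finset.range N, f i),
    fun n => Nat.pow_le_pow_right two_pos ?_⟩
  simp only [Polynomial.eval_add, Polynomial.eval_mul, Polynomial.eval_C, Polynomial.eval_pow,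
    Polynomial.eval_X]
  rcases lt_or_ge n N with hn | hn
  · exact le_add_left (Finset.single_le_sum (fun i _ => Nat.zero_le (f i)) (Finset.mem_range.2 hn))
  · have bound := hN n hn
    rw [Real.norm_natCast, norm_pow, Real.norm_natCast] at bound
    have natCast_bound : (f n : ℝ) ≤ ⌈c⌉₊ * (n : ℝ) ^ k :=
      bound.trans (mul_le_mul_of_nonneg_right (Nat.le_ceil c) (by positivity))
    exact le_add_right (by exact_mod_cast natCast_bound)

theorem sampleTime (G : GateSet) (hf : ExpBounded f) (hg : ExpBounded fun n => 2 ^ g n) :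
    ExpBounded fun n => QCirc.sampleTime G (f n) (g n) := by
  have hg' : ExpBounded g := hg.mono fun n => Nat.lt_two_pow_self.le
  have hround : ExpBounded fun n => roundTime (f n) := by
    simp only [roundTime, pow_two]
    exact (const _).mul ((hf.add (const _)).mul (hf.add (const _)))
  have hpower : ExpBounded fun n => 2 ^ g n * ((roundProg G).width * roundTime (f n)) :=
    hg.mul ((const _).mul hround)
  exact hround.add (((hg'.mul (((const 9).mul hpower).add (const 6))).add (const 1)).add
    ((((const 2).mul hpower).add ((const 2).mul hg')).add (const 4)))

end ExpBounded

section family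

open Computability

variable {G : GateSet} {ℓ : ℕ → ℕ} {C : ∀ n, Circuit G (ℓ n) 1}
  {D : ∀ n, Circuit (extGates G) 0 (ℓ n)}

theorem exists_sampleCircuit (C : ∀ n, Circuit G (ℓ n) 1) :
    ∃ D : ∀ n, Circuit (extGates G) 0 (ℓ n),
      ∀ n, (D n).layers = sampleLayers (ℓ n) (C n).layers := by
  choose D hD using fun n => (composable_sampleLayers (C n).composable).exists_circuit
  exact ⟨D, hD⟩

theorem length_unaryEncodeNat (n : ℕ) : (unaryEncodeNat n).length = n := by
  induction n with
  | zero => rfl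
  | succ n ih => rw [unaryEncodeNat, List.length_cons, ih]

theorem nonempty_tm2ComputableInTime_unaryEncodeNat {β : Type} {eb : β → List Bool} {f : ℕ → β}
    (M : TM2Computable unaryEncodeNat eb f) :
    Nonempty (TM2ComputableInTime unaryEncodeNat eb f) :=
  ⟨{ M with
    time := fun n => (M.outputsFun n).steps
    outputsFun := fun n => ⟨M.outputsFun n, by rw [length_unaryEncodeNat]⟩ }⟩

theorem exists_tm2ComputableInTime_sample
    (M : TM2ComputableInTime unaryEncodeNat id fun n => (C n).code)
    (hD : ∀ n, (D n).layers = sampleLayers (ℓ n) (C n).layers) :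
    ∃ c, (∀ n, (C n).code.length ≤ n + c * M.time n) ∧
      ∃ M' : TM2ComputableInTime unaryEncodeNat id fun n => (D n).code, ∀ n, M'.time n =
        M.time n + (n + c * M.time n + 1) + sampleTime G (C n).code.length (ℓ n) + 1 := by
  obtain ⟨c, length_le, compose⟩ := exists_tm2ComputableInTime_of_exec
    (g := fun n => (D n).code) M (sampleProg G) .t .i
  simp only [length_unaryEncodeNat] at length_le compose
  exact ⟨c, length_le, compose _ fun n => exec_sampleProg (C n) (D n) (hD n)⟩

theorem IsUniform.sample (hC : IsUniform C)
    (hD : ∀ n, (D n).layers = sampleLayers (ℓ n) (C n).layers) : IsUniform D := by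
  obtain ⟨M⟩ := hC
  obtain ⟨M⟩ := nonempty_tm2ComputableInTime_unaryEncodeNat M
  obtain ⟨-, -, M', -⟩ := exists_tm2ComputableInTime_sample M hD
  exact ⟨M'.toTM2Computable⟩

theorem IsExpTime.sample (hC : IsExpTime C) {k : ℕ}
    (hℓ : (fun n : ℕ => (ℓ n : ℝ)) =O[atTop] fun n : ℕ => (n : ℝ) ^ k)
    (hD : ∀ n, (D n).layers = sampleLayers (ℓ n) (C n).layers) : IsExpTime D := by
  obtain ⟨M, hM : ExpBounded M.time⟩ := hC
  obtain ⟨c, length_le, M', time_eq⟩ := exists_tm2ComputableInTime_sample M hD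
  have output_bounded : ExpBounded fun n => n + c * M.time n :=
    .add .natCast (.mul (.const c) hM)
  have sample_bounded : ExpBounded fun n => sampleTime G (C n).code.length (ℓ n) :=
    (output_bounded.mono length_le).sampleTime G (.two_pow_of_isBigO hℓ)
  have time_bounded : ExpBounded M'.time :=
    (((hM.add (output_bounded.add (.const 1))).add sample_bounded).add (.const 1)).mono
      fun n => (time_eq n).le
  exact ⟨M', time_bounded⟩

end family

/-! ### Negligible functions -/

theorem eventually_inv_two_pow_le {ℓ : ℕ → ℕ}
    (h : (fun n : ℕ => Real.logb 2 (n : ℝ)) =o[atTop] fun n : ℕ => (ℓ n : ℝ)) (c : ℕ) :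
    ∀ᶠ n : ℕ in atTop, ((2 : ℝ) ^ ℓ n)⁻¹ ≤ ((n : ℝ) ^ c)⁻¹ := by
  filter_upwards [h.bound (c := ((c : ℝ) + 1)⁻¹) (by positivity), eventually_ge_atTop 1]
    with n bound one_le
  have n_pos : (0 : ℝ) < n := by exact_mod_cast one_le
  have log_nonneg : 0 ≤ Real.logb 2 n := Real.logb_nonneg one_lt_two (by exact_mod_cast one_le)
  rw [Real.norm_of_nonneg log_nonneg, Real.norm_natCast, inv_mul_eq_div,
    le_div_iff₀ (by positivity)] at bound
  refine inv_anti₀ (by positivity) ?_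
  rw [← Real.rpow_natCast, ← Real.rpow_natCast,
    ← Real.logb_le_iff_le_rpow one_lt_two (by positivity), Real.logb_rpow_eq_mul_logb_of_pos n_pos]
  linarith

theorem exists_eventually_eval_le_pow (p : Polynomial ℝ) :
    ∃ d : ℕ, ∀ᶠ n : ℕ in atTop, p.eval (n : ℝ) ≤ (n : ℝ) ^ d := by
  have isBigO := p.isBigO_atTop_of_degree_le (Polynomial.X ^ p.natDegree)
    (by rw [Polynomial.degree_X_pow]; exact Polynomial.degree_le_natDegree)
  obtain ⟨c, hc⟩ := (isBigO.comp_tendsto tendsto_natCast_atTop_atTop).bound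
  refine ⟨p.natDegree + 1, ?_⟩
  filter_upwards [hc, eventually_ge_atTop ⌈c⌉₊] with n bound le_n
  simp only [Function.comp_apply, Polynomial.eval_pow, Polynomial.eval_X, norm_pow,
    Real.norm_natCast] at bound
  rw [pow_succ']
  exact (le_abs_self _).trans (bound.trans (mul_le_mul_of_nonneg_right (Nat.ceil_le.1 le_n)
    (by positivity)))

theorem Negligible.of_le_eval_mul {ℓ : ℕ → ℕ} {f g : ℕ → ℝ} {p : Polynomial ℝ}
    (h : ∀ᶠ n : ℕ in atTop, f n ≤ p.eval (n : ℝ) * (((2 : ℝ) ^ ℓ n)⁻¹ + g n))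
    (hg₀ : ∀ n, 0 ≤ g n) (hg : Negligible g)
    (hℓ : (fun n : ℕ => Real.logb 2 (n : ℝ)) =o[atTop] fun n : ℕ => (ℓ n : ℝ)) :
    Negligible f := by
  intro c
  obtain ⟨d, hd⟩ := exists_eventually_eval_le_pow p
  filter_upwards [h, hd, hg (c + d + 1), eventually_inv_two_pow_le hℓ (c + d + 1),
    eventually_ge_atTop 2] with n f_le eval_le g_le inv_le two_le
  have two_le_cast : (2 : ℝ) ≤ n := by exact_mod_cast two_le
  have n_pos : (0 : ℝ) < n := by linarith
  calc f n ≤ p.eval (n : ℝ) * (((2 : ℝ) ^ ℓ n)⁻¹ + g n) := f_le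
    _ ≤ (n : ℝ) ^ d * (((2 : ℝ) ^ ℓ n)⁻¹ + g n) :=
      mul_le_mul_of_nonneg_right eval_le (add_nonneg (by positivity) (hg₀ n))
    _ ≤ (n : ℝ) ^ d * (((n : ℝ) ^ (c + d + 1))⁻¹ + ((n : ℝ) ^ (c + d + 1))⁻¹) := by gcongr
    _ = ((n : ℝ) ^ c)⁻¹ * (2 / n) := by field_simp; ring
    _ ≤ ((n : ℝ) ^ c)⁻¹ :=
      mul_le_of_le_one_right (by positivity) ((div_le_one n_pos).2 two_le_cast)

end QCirc

end

theorem mainTheorem3 :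
    (∀ (ℓ : ℕ → ℕ) (s : ∀ n, QCirc.Bits (ℓ n)), QCirc.ComputablyIngenerable s →
      ∀ (G : QCirc.GateSet) (C : ∀ n, QCirc.Circuit G (ℓ n) 1), QCirc.IsUniform C →
        (∃ p : Polynomial ℝ, ∀ᶠ n : ℕ in Filter.atTop,
          QCirc.acceptProb (C n) (s n) ≤
            p.eval (n : ℝ) * (((2 : ℝ) ^ ℓ n)⁻¹ + QCirc.avgAcceptProb (C n))) ∧
        (((fun n : ℕ => Real.logb 2 (n : ℝ)) =o[Filter.atTop] fun n : ℕ => (ℓ n : ℝ)) →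
          QCirc.Negligible (fun n => QCirc.avgAcceptProb (C n)) →
          QCirc.Negligible (fun n => QCirc.acceptProb (C n) (s n)))) ∧
    (∀ (ℓ : ℕ → ℕ) (s : ∀ n, QCirc.Bits (ℓ n)),
      (∃ k : ℕ, (fun n : ℕ => (ℓ n : ℝ)) =O[Filter.atTop] fun n : ℕ => (n : ℝ) ^ k) →
      QCirc.ExpTimeIngenerable s →
      ∀ (G : QCirc.GateSet) (C : ∀ n, QCirc.Circuit G (ℓ n) 1), QCirc.IsExpTime C →
        (∃ p : Polynomial ℝ, ∀ᶠ n : ℕ in Filter.atTop,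
          QCirc.acceptProb (C n) (s n) ≤
            p.eval (n : ℝ) * (((2 : ℝ) ^ ℓ n)⁻¹ + QCirc.avgAcceptProb (C n))) ∧
        (((fun n : ℕ => Real.logb 2 (n : ℝ)) =o[Filter.atTop] fun n : ℕ => (ℓ n : ℝ)) →
          QCirc.Negligible (fun n => QCirc.avgAcceptProb (C n)) →
          QCirc.Negligible (fun n => QCirc.acceptProb (C n) (s n)))) := by
  refine ⟨fun ℓ s hs G C hC => ?_, fun ℓ s ⟨k, hℓ⟩ hs G C hC => ?_⟩
  · obtain ⟨D, hD⟩ := QCirc.exists_sampleCircuit C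
    obtain ⟨p, hp⟩ := hs (QCirc.extGates G)
    have bound := (hp D (hC.sample hD)).mono fun n hn =>
      QCirc.acceptProb_le_of_prob_lt (C n) (D n) (hD n) (s n) hn
    exact ⟨⟨p, bound⟩, fun hω havg => .of_le_eval_mul bound
      (fun n => QCirc.avgAcceptProb_nonneg (C n)) havg hω⟩
  · obtain ⟨D, hD⟩ := QCirc.exists_sampleCircuit C
    obtain ⟨p, hp⟩ := hs (QCirc.extGates G)
    have bound := (hp D (hC.sample hℓ hD)).mono fun n hn =>
      QCirc.acceptProb_le_of_prob_lt (C n) (D n) (hD n) (s n) hn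
    exact ⟨⟨p, bound⟩, fun hω havg => .of_le_eval_mul bound
      (fun n => QCirc.avgAcceptProb_nonneg (C n)) havg hω⟩
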